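/- Let $E=\{z\in\mathbb C:|z|<1\}$ and let $A$ be the class of functions $f$ analytic in $E$ with $f(z)=z+a_2z^2+\cdots$. Let $\alpha>0$, let $n\ge 0$ be an integer, and let $D$ be the Salagean operator, $D^0h=h$, $D^{n}h(z)=z\,(D^{n-1}h)'(z)$. For $f\in A$, the power $f(z)^\alpha$ means $z^\alpha g(z)$, where $z^\alpha$ is the principal value and $g$ is the analytic function on $E$ (assumed to exist) that equals the principal power $(f(z)/z)^\alpha$ near the origin, so that $$f(z)^\alpha=z^\alpha+\sum_{k=2}^\infty a_k(\alpha)z^{\alpha+k-1}.$$ The quotient $D^n(f(z)^\alpha)/(\alpha^nz^\alpha)$, $z\in E\setminus\{0\}$, is computed with any branch of $z^\alpha$ analytic near the point considered, and does not depend on the branch. For $0\le\delta<1$ let $T_n^\alpha(\delta)$ be the class of all $f\in A$ for which such a $g$ exists and $$\operatorname{Re}\frac{D^n(f(z)^\alpha)}{\alpha^nz^\alpha}>\delta\qquad(z\in E\setminus\{0\}).$$ Let $A_0=4.5678018\ldots$ be the unique positive root of $9x^7+55x^6-14x^5-948x^4-3247x^3-5013x^2-3780x-1134$. **Theorem 3.1.**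 Let $0\le\beta<1$, let $c$ be real with $0<\alpha+c\le A_0$, and let $f\in T_n^\alpha(\beta)$. Let $$F(z)^\alpha=\frac{\alpha+c}{z^c}\int_0^z t^{c-1}f(t)^\alpha\,dt$$ be the generalized Bernardi integral of $f$, and for $m\ge1$ let $$F_m(z)^\alpha=z^\alpha+\sum_{k=2}^m\frac{\alpha+c}{\alpha+k+c-1}\,a_k(\alpha)\,z^{\alpha+k-1}$$ be its $m$-th quasi-partial sum. Then $F_m(z)^\alpha\to F(z)^\alpha$ as $m\to\infty$ for every $z\in E\setminus\{0\}$, and for every $m\ge 1$ $$\operatorname{Re}\frac{D^n(F_m(z)^\alpha)}{\alpha^nz^\alpha}>\delta:=1-\frac{2(1-\beta)(\alpha+c)}{\alpha+c+1}\qquad(z\in E\setminus\{0\}).$$ Moreover $\delta\ge0$ if and only if $\beta\ge\frac{\alpha+c-1}{2(\alpha+c)}$, and in that case, for every $m\ge1$, there is a function $F_m\in A$ whose power $F_m(z)^\alpha$ is the quasi-partial sum above, and $F_m\in T_n^\alpha(\delta)$. -/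

import Mathlib

open Filter Topology

namespace QuasiPartial

/-- The class `A`: analytic in the unit disk, with `f(z) = z + a₂ z² + ⋯`. -/
def ClassA (f : ℂ → ℂ) : Prop :=
  DifferentiableOn ℂ f (Metric.ball 0 1) ∧ f 0 = 0 ∧ deriv f 0 = 1

/-- `g` is the analytic function `f(z)^α / z^α` on the unit disk: it is analytic there and, near
the origin, it is the principal power `(f(z)/z)^α` (so `g 0 = 1` when `f` is in the class `A`).
Such a `g` is unique on the disk, and `f(z)^α` means `z^α g(z)`. -/
def IsPowerQuotient (α : ℝ) (f g : ℂ → ℂ) : Prop :=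
  DifferentiableOn ℂ g (Metric.ball 0 1) ∧ ∀ᶠ z in 𝓝[≠] (0 : ℂ), g z = (f z / z) ^ (α : ℂ)

/-- `z^α g(z)`, with the principal value of `z^α`. With `g` the power quotient of `f`, this
is `f(z)^α = z^α + ∑_{k ≥ 2} a_k(α) z^(α+k-1)`. -/
noncomputable def mulPow (α : ℝ) (g : ℂ → ℂ) (z : ℂ) : ℂ := z ^ (α : ℂ) * g z

/-- The Salagean operator `D h(z) = z h'(z)`; its iterates are `salagean^[n]`. -/
noncomputable def salagean (h : ℂ → ℂ) (z : ℂ) : ℂ := z * deriv h z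

/-- For `z₀ ≠ 0`, the branch of `ζ ↦ ζ^α` that is analytic near `z₀` and takes the principal
value `z₀^α` at `z₀`. Near a point off the negative real axis it is the principal power itself
(see `branchPow_eventuallyEq`). -/
noncomputable def branchPow (α : ℝ) (z₀ ζ : ℂ) : ℂ := z₀ ^ (α : ℂ) * (ζ / z₀) ^ (α : ℂ)

theorem branchPow_eventuallyEq (α : ℝ) {z₀ : ℂ} (h : z₀ ∈ Complex.slitPlane) :
    branchPow α z₀ =ᶠ[𝓝 z₀] fun ζ => ζ ^ (α : ℂ) := by
  have hz : z₀ ≠ 0 := Complex.slitPlane_ne_zero h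
  have h1 : ContinuousAt (fun ζ : ℂ => z₀.arg + (ζ / z₀).arg) z₀ := by
    have h2 : ContinuousAt (fun ζ : ℂ => ζ / z₀) z₀ := by fun_prop
    have h3 : ContinuousAt Complex.arg (z₀ / z₀) := by
      rw [div_self hz]
      exact Complex.continuousAt_arg Complex.one_mem_slitPlane
    exact continuousAt_const.add (ContinuousAt.comp (f := fun ζ : ℂ => ζ / z₀) h3 h2)
  have h4 : Set.Ioo (-Real.pi) Real.pi ∈ 𝓝 (z₀.arg + (z₀ / z₀).arg) := by
    rw [div_self hz, Complex.arg_one, add_zero]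
    exact Ioo_mem_nhds (Complex.neg_pi_lt_arg z₀)
      (lt_of_le_of_ne (Complex.arg_le_pi z₀) (Complex.mem_slitPlane_iff_arg.mp h).1)
  filter_upwards [h1.eventually h4, eventually_ne_nhds hz] with ζ hζ hζ0
  have hd : ζ / z₀ ≠ 0 := div_ne_zero hζ0 hz
  have hl := Complex.log_mul hz hd ⟨hζ.1, hζ.2.le⟩
  rw [mul_div_cancel₀ ζ hz] at hl
  rw [branchPow, Complex.cpow_def_of_ne_zero hz, Complex.cpow_def_of_ne_zero hd,
    Complex.cpow_def_of_ne_zero hζ0, ← Complex.exp_add, hl, add_mul]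

/-- The quotient `Dⁿ(f(z)^α) / (αⁿ z^α)` at a point `z ≠ 0`, where `f(ζ)^α = ζ^α g(ζ)`. The value
does not depend on the branch of `ζ^α` near `z`, so there is no exception on the negative axis. -/
noncomputable def salageanQuotient (n : ℕ) (α : ℝ) (g : ℂ → ℂ) (z : ℂ) : ℂ :=
  (salagean^[n] (fun ζ => branchPow α z ζ * g ζ)) z / ((α : ℂ) ^ n * z ^ (α : ℂ))

/-- The class `T_n^α(β)`. -/
def opoolaClass (n : ℕ) (α β : ℝ) : Set (ℂ → ℂ) :=
  {f | ClassA f ∧ ∃ g, IsPowerQuotient α f g ∧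
    ∀ z : ℂ, ‖z‖ < 1 → z ≠ 0 → β < (salageanQuotient n α g z).re}

/-- The generalized Bernardi integral `F(z)^α = ((α+c)/z^c) ∫₀^z t^(c-1) P(t) dt` of `P = f^α`,
with principal powers and the integral along the segment `t = s z`, `0 ≤ s ≤ 1`. -/
noncomputable def bernardi (α c : ℝ) (P : ℂ → ℂ) (z : ℂ) : ℂ :=
  ((α + c : ℝ) : ℂ) / z ^ (c : ℂ) *
    ∫ s in (0 : ℝ)..1, ((s * z) ^ ((c : ℂ) - 1) * P (s * z)) * z

/-- The coefficient `a_k(α)` (`k ≥ 1`) of `z^(α+k-1)` in `f(z)^α = z^α g(z)`. -/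
noncomputable def powCoeff (g : ℂ → ℂ) (k : ℕ) : ℂ :=
  iteratedDeriv (k - 1) g 0 / ((k - 1).factorial : ℂ)

/-- `F_m(z)^α / z^α = 1 + ∑_{k=2}^m (α+c)/(α+k+c-1) a_k(α) z^(k-1)`, where `F_m(z)^α` is the `m`-th
quasi-partial sum of the generalized Bernardi integral of `f(z)^α = z^α g(z)`. -/
noncomputable def quasiPartialQuotient (α c : ℝ) (g : ℂ → ℂ) (m : ℕ) (z : ℂ) : ℂ :=
  1 + ∑ k ∈ Finset.Icc 2 m, (((α + c) / (α + k + c - 1) : ℝ) : ℂ) * powCoeff g k * z ^ (k - 1)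

/-- A polynomial with exactly one positive root. -/
noncomputable def septic (x : ℝ) : ℝ :=
  9 * x ^ 7 + 55 * x ^ 6 - 14 * x ^ 5 - 948 * x ^ 4 - 3247 * x ^ 3 - 5013 * x ^ 2 - 3780 * x - 1134

theorem exists_septic_root :
    ∃ x : ℝ, x ∈ Set.Ioo (4.5678018 : ℝ) 4.5678019 ∧ septic x = 0 := by
  have hc : ContinuousOn septic (Set.Icc (4.5678018 : ℝ) 4.5678019) := by
    unfold septic; fun_prop
  have := intermediate_value_Ioo (by norm_num) hc
  have h0 : (0 : ℝ) ∈ Set.Ioo (septic 4.5678018) (septic 4.5678019) := by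
    unfold septic; constructor <;> norm_num
  obtain ⟨x, hx, h⟩ := this h0
  exact ⟨x, hx, h⟩

theorem existsUnique_septic_root : ∃! x : ℝ, 0 < x ∧ septic x = 0 := by
  have key : ∀ x y : ℝ, 0 < x → x < y → septic x = 0 → septic y = 0 → False := by
    intro x y hx hxy h1 h2
    have hy : 0 < y := hx.trans hxy
    have e : septic y * x ^ 5 - septic x * y ^ 5 = (y - x) * (x ^ 5 * y ^ 5 * (9 * (x + y) + 55)
        + 948 * (x * y) ^ 4 + 3247 * (x * y) ^ 3 * (x + y)
        + 5013 * (x * y) ^ 2 * (x ^ 2 + x * y + y ^ 2)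
        + 3780 * (x * y) * ((x + y) * (x ^ 2 + y ^ 2))
        + 1134 * (x ^ 4 + x ^ 3 * y + x ^ 2 * y ^ 2 + x * y ^ 3 + y ^ 4)) := by
      unfold septic; ring
    have hd : 0 < y - x := by linarith
    have : 0 < septic y * x ^ 5 - septic x * y ^ 5 := by rw [e]; positivity
    rw [h1, h2] at this
    linarith
  obtain ⟨x, hx, h⟩ := exists_septic_root
  have hx0 : 0 < x := lt_trans (by norm_num) hx.1
  refine ⟨x, ⟨hx0, h⟩, fun y hy => ?_⟩
  rcases lt_trichotomy y x with hlt | heq | hgt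
  · exact (key y x hy.1 hlt hy.2 h).elim
  · exact heq
  · exact (key x y hx0 hgt h hy.2).elim

/-- The constant `4.5678018…`, as the unique positive root of `septic`: the largest `A` such that
`1/(1+γ) + ∑_{k=1}^l cos(kθ)/(k+γ) ≥ 0` for all `-1 < γ ≤ A`, all real `θ` and all `l ≥ 1`. -/
noncomputable def gasperConstant : ℝ := existsUnique_septic_root.choose

theorem gasperConstant_mem : gasperConstant ∈ Set.Ioo (4.5678018 : ℝ) 4.5678019 := by
  obtain ⟨x, hx, h⟩ := exists_septic_root
  have hx0 : 0 < x := lt_trans (by norm_num) hx.1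
  have := existsUnique_septic_root.choose_spec.2 x ⟨hx0, h⟩
  rw [gasperConstant, ← this]
  exact hx

end QuasiPartial

/-!
The quotient `Dⁿ(f^α) / (αⁿ z^α)` is an ordinary analytic function on the disk: writing
`f^α = z^α g`, the Salagean operator turns `g` into `α (g + z g'/α)`, so the quotient is
`h = Tⁿ g` with `T g = g + z g'/α` (`salageanQuotient_eq`). The operator `T` multiplies the `k`-th
Taylor coefficient by `1 + k/α`, hence commutes with the passage to quasi-partial sums. What has to
be shown is that if `h(0) = 1` and `Re h > β` on the disk, then, with `γ = α + c`,
`1 + ∑_{k=1}^l γ/(γ+k) h_k z^k` has real part larger than `1 - 2(1-β)γ/(γ+1)`.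

Averaging `Re (h - β) ≥ 0` over a circle against twice a real trigonometric polynomial reproduces
the Hadamard product of the two (`neg_two_mul_le_re_sum_powCoeff`). So it suffices that
`∑_{k=1}^l cos(kθ)/(k+γ) ≥ -1/(1+γ)`, which is Gasper's theorem (`cosineSum_nonneg`) and accounts
for the constant `A₀`. The inequality becomes strict because in the open disk the `k`-th term is
damped by `ρ^k` with `ρ < 1`.

Gasper's theorem for `γ < A₀` follows from `γ = A₀` by summation by parts. For `γ = A₀`, multiply the
sum by `2 sin(θ/2)` and sum by parts again: the result is at least a quantity `abelMinorant γ l θ`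
that increases with `l`. One nonnegative value of it therefore settles all longer sums:
* for `sin(θ/2) ≥ 0.239` the value at `l = 4` is nonnegative, and the sums with one, two or three
  cosines are polynomials in `cos θ`; the cubic has a double root exactly because its discriminant
  is a multiple of the septic that defines `A₀`;
* for `0.11 ≤ sin(θ/2) ≤ 0.24` the value at `l = 7` is nonnegative;
* for smaller `θ`, with `q` the integer part of `π/(2θ)`, the value at `l = 2q - 1` is nonnegative
  by Jordan's inequality.
In the last two cases the shorter sums only involve the nonnegative first half wave of the sine.

The limit of the quasi-partial sums is found by integrating the power series of `g` term by term.
If the bound `δ` is nonnegative, then `Re T Q > δ` implies `Re Q > δ ≥ 0` by integration along rays,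
so the polynomial `Q` has an analytic logarithm and is the power quotient of `z Q(z)^(1/α)`.
-/

namespace QuasiPartial

/-! ### Cosine sums and summation by parts -/

/-- The cosine sum `1/(1+γ) + ∑_{k=1}^l cos(kθ)/(k+γ)`; the constant term repeats the coefficient
of `cos θ`. -/
noncomputable def cosineSum (γ : ℝ) (l : ℕ) (θ : ℝ) : ℝ :=
  1 / (1 + γ) + ∑ k ∈ Finset.range l, Real.cos ((k + 1) * θ) / (k + 1 + γ)

/-- What summation by parts leaves of `2 sin(θ/2) cosineSum γ l θ` when the last sine is replaced
by its least value `-1`. It increases with `l`, so one nonnegative value settles all later sums. -/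
noncomputable def abelMinorant (γ : ℝ) (l : ℕ) (θ : ℝ) : ℝ :=
  (Real.sin (θ / 2) - 1) / (1 + γ) +
    ∑ k ∈ Finset.range l, (1 + Real.sin ((k + 3 / 2) * θ)) / ((k + 1 + γ) * (k + 2 + γ))

theorem two_mul_sin_half_mul_cos (x θ : ℝ) :
    2 * Real.sin (θ / 2) * Real.cos (x * θ) =
      Real.sin ((x + 1 / 2) * θ) - Real.sin ((x - 1 / 2) * θ) := by
  rw [show (x + 1 / 2) * θ = x * θ + θ / 2 by ring, show (x - 1 / 2) * θ = x * θ - θ / 2 by ring,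
    Real.sin_add, Real.sin_sub]
  ring

theorem two_mul_sin_half_mul_cosineSum {γ : ℝ} (hγ : -1 < γ) (l : ℕ) (θ : ℝ) :
    2 * Real.sin (θ / 2) * cosineSum γ l θ =
      abelMinorant γ l θ + (1 + Real.sin ((l + 1 / 2) * θ)) / (l + 1 + γ) := by
  induction l with
  | zero =>
    have : 1 + γ ≠ 0 := ne_of_gt (by linarith)
    simp only [cosineSum, abelMinorant, Finset.range_zero, Finset.sum_empty, Nat.cast_zero, zero_add]
    rw [show 1 / 2 * θ = θ / 2 by ring]
    field_simp
    ring
  | succ l ih =>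
    have h1 : (l : ℝ) + 1 + γ ≠ 0 := ne_of_gt (by linarith [(Nat.cast_nonneg l : (0 : ℝ) ≤ l)])
    have h2 : (l : ℝ) + 2 + γ ≠ 0 := ne_of_gt (by linarith [(Nat.cast_nonneg l : (0 : ℝ) ≤ l)])
    have hc := two_mul_sin_half_mul_cos (l + 1) θ
    have e1 : cosineSum γ (l + 1) θ =
        cosineSum γ l θ + Real.cos ((l + 1) * θ) / (l + 1 + γ) := by
      simp only [cosineSum, Finset.sum_range_succ, add_assoc]
    have e2 : abelMinorant γ (l + 1) θ = abelMinorant γ l θ +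
        (1 + Real.sin ((l + 3 / 2) * θ)) / ((l + 1 + γ) * (l + 2 + γ)) := by
      simp only [abelMinorant, Finset.sum_range_succ, add_assoc]
    rw [show ((l : ℝ) + 1 + 1 / 2) = l + 3 / 2 by ring,
      show ((l : ℝ) + 1 - 1 / 2) = l + 1 / 2 by ring] at hc
    rw [e1, e2, mul_add, ih, mul_div_assoc', hc]
    push_cast
    rw [show ((l : ℝ) + 1 + 1 / 2) = l + 3 / 2 by ring,
      show ((l : ℝ) + 1 + 1 + γ) = l + 2 + γ by ring]
    field_simp
    ring

theorem abelMinorant_mono {γ : ℝ} (hγ : -1 < γ) (θ : ℝ) :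
    Monotone fun l => abelMinorant γ l θ := by
  refine monotone_nat_of_le_succ fun l => ?_
  simp only [abelMinorant, Finset.sum_range_succ, ← add_assoc]
  have h0 : (0 : ℝ) ≤ l := l.cast_nonneg
  have h1 : 0 < (l : ℝ) + 1 + γ := by linarith
  have h2 : 0 < (l : ℝ) + 2 + γ := by linarith
  have h3 := Real.neg_one_le_sin ((l + 3 / 2) * θ)
  have h4 : 0 ≤ 1 + Real.sin ((l + 3 / 2) * θ) := by linarith
  have : 0 ≤ (1 + Real.sin ((l + 3 / 2) * θ)) / ((l + 1 + γ) * (l + 2 + γ)) := by positivity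
  linarith

theorem cosineSum_nonneg_of_abelMinorant_nonneg {γ θ : ℝ} (hγ : -1 < γ)
    (hθ : 0 < Real.sin (θ / 2)) {l₀ l : ℕ} (h : 0 ≤ abelMinorant γ l₀ θ) (hl : l₀ ≤ l) :
    0 ≤ cosineSum γ l θ := by
  have h1 := two_mul_sin_half_mul_cosineSum hγ l θ
  have h2 : abelMinorant γ l₀ θ ≤ abelMinorant γ l θ := abelMinorant_mono hγ θ hl
  have h0 : (0 : ℝ) ≤ l := l.cast_nonneg
  have h3 := Real.neg_one_le_sin ((l + 1 / 2) * θ)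
  have h4 : 0 ≤ (1 + Real.sin ((l + 1 / 2) * θ)) / (l + 1 + γ) :=
    div_nonneg (by linarith) (by linarith)
  refine nonneg_of_mul_nonneg_right (a := 2 * Real.sin (θ / 2)) ?_ (by linarith)
  linarith

theorem abelMinorant_add {γ : ℝ} (hγ : -1 < γ) (l : ℕ) (θ : ℝ) :
    abelMinorant γ l θ + 1 / (l + 1 + γ) = Real.sin (θ / 2) / (1 + γ) +
      ∑ k ∈ Finset.range l, Real.sin ((k + 3 / 2) * θ) / ((k + 1 + γ) * (k + 2 + γ)) := by
  induction l with
  | zero =>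
    simp only [abelMinorant, Finset.range_zero, Finset.sum_empty, Nat.cast_zero, zero_add]
    ring
  | succ l ih =>
    have h1 : (l : ℝ) + 1 + γ ≠ 0 := ne_of_gt (by linarith [(Nat.cast_nonneg l : (0 : ℝ) ≤ l)])
    have h2 : (l : ℝ) + 2 + γ ≠ 0 := ne_of_gt (by linarith [(Nat.cast_nonneg l : (0 : ℝ) ≤ l)])
    rw [Finset.sum_range_succ, ← add_assoc, ← ih]
    simp only [abelMinorant, Finset.sum_range_succ]
    push_cast
    rw [show ((l : ℝ) + 1 + 1 + γ) = l + 2 + γ by ring]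
    field_simp
    ring

/-- As long as every sine produced by summation by parts lies in the first half period, the cosine
sum is a sum of nonnegative terms. -/
theorem cosineSum_nonneg_of_mul_le_pi {γ θ : ℝ} (hγ : -1 < γ) (hθ : 0 < θ) (hπ : θ ≤ Real.pi)
    {l : ℕ} (hl : (l + 1 / 2) * θ ≤ Real.pi) : 0 ≤ cosineSum γ l θ := by
  have hsin : ∀ x : ℝ, 0 ≤ x → x ≤ l + 1 / 2 → 0 ≤ Real.sin (x * θ) := fun x h0 h1 =>
    Real.sin_nonneg_of_nonneg_of_le_pi (by positivity) ((by gcongr : x * θ ≤ _).trans hl)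
  have hs : 0 < Real.sin (θ / 2) :=
    Real.sin_pos_of_pos_of_lt_pi (by linarith) (by linarith)
  have h1 := two_mul_sin_half_mul_cosineSum hγ l θ
  rw [add_div, ← add_assoc, abelMinorant_add hγ] at h1
  have h0 : (0 : ℝ) ≤ l := l.cast_nonneg
  have h2 : 0 ≤ ∑ k ∈ Finset.range l,
      Real.sin ((k + 3 / 2) * θ) / ((k + 1 + γ) * (k + 2 + γ)) := by
    refine Finset.sum_nonneg fun k hk => div_nonneg (hsin _ (by positivity) ?_) ?_
    · have : ((k : ℝ) + 1) ≤ l := by exact_mod_cast Finset.mem_range.mp hk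
      linarith
    · have h0 : (0 : ℝ) ≤ k := k.cast_nonneg
      exact mul_nonneg (by linarith) (by linarith)
  have h3 : 0 ≤ Real.sin ((l + 1 / 2) * θ) / (l + 1 + γ) :=
    div_nonneg (hsin _ (by positivity) le_rfl) (by linarith)
  have h4 : 0 ≤ Real.sin (θ / 2) / (1 + γ) := div_nonneg hs.le (by linarith)
  refine nonneg_of_mul_nonneg_right (a := 2 * Real.sin (θ / 2)) ?_ (by linarith)
  linarith

/-- Summation by parts against nonincreasing weights, of which the first occurs twice. -/
theorem weighted_sum_nonneg {w b : ℕ → ℝ} {b₀ : ℝ} (hw : Antitone w) (hw0 : ∀ k, 0 ≤ w k)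
    (hb : ∀ l, 0 ≤ b₀ + ∑ k ∈ Finset.range l, b k) (l : ℕ) :
    0 ≤ w 0 * b₀ + ∑ k ∈ Finset.range l, w k * b k := by
  have key : ∀ l, w l * (b₀ + ∑ k ∈ Finset.range l, b k) ≤
      w 0 * b₀ + ∑ k ∈ Finset.range l, w k * b k := by
    intro l
    induction l with
    | zero => simp
    | succ l ih =>
      have h1 := mul_le_mul_of_nonneg_right (hw l.le_succ) (hb (l + 1))
      rw [Finset.sum_range_succ] at h1 ⊢
      rw [Finset.sum_range_succ (fun k => w k * b k)]
      simp only [Nat.succ_eq_add_one] at h1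
      linarith
  exact (mul_nonneg (hw0 l) (hb l)).trans (key l)

/-! ### Angles that are not small -/

theorem sin_add_three_halves_mul (x θ : ℝ) :
    Real.sin ((x + 1 + 3 / 2) * θ) = 2 * (1 - 2 * Real.sin (θ / 2) ^ 2) *
      Real.sin ((x + 3 / 2) * θ) - Real.sin ((x + 1 / 2) * θ) := by
  have hc : Real.cos θ = 1 - 2 * Real.sin (θ / 2) ^ 2 := by
    rw [show θ = 2 * (θ / 2) by ring, Real.cos_two_mul, Real.cos_sq']
    ring_nf
  rw [← hc, show (x + 1 + 3 / 2) * θ = (x + 3 / 2) * θ + θ by ring,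
    show (x + 1 / 2) * θ = (x + 3 / 2) * θ - θ by ring, Real.sin_add, Real.sin_sub]
  ring

/-- The odd multiples of `θ/2` up to `17 θ/2`, as polynomials in `s = sin(θ/2)`. -/
theorem sin_half_odd_mul (θ : ℝ) {s : ℝ} (hs : s = Real.sin (θ / 2)) :
    Real.sin (3 / 2 * θ) = 3 * s - 4 * s ^ 3 ∧
    Real.sin (5 / 2 * θ) = 5 * s - 20 * s ^ 3 + 16 * s ^ 5 ∧
    Real.sin (7 / 2 * θ) = 7 * s - 56 * s ^ 3 + 112 * s ^ 5 - 64 * s ^ 7 ∧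
    Real.sin (9 / 2 * θ) = 9 * s - 120 * s ^ 3 + 432 * s ^ 5 - 576 * s ^ 7 + 256 * s ^ 9 ∧
    Real.sin (11 / 2 * θ) =
      11 * s - 220 * s ^ 3 + 1232 * s ^ 5 - 2816 * s ^ 7 + 2816 * s ^ 9 - 1024 * s ^ 11 ∧
    Real.sin (13 / 2 * θ) = 13 * s - 364 * s ^ 3 + 2912 * s ^ 5 - 9984 * s ^ 7 + 16640 * s ^ 9
      - 13312 * s ^ 11 + 4096 * s ^ 13 ∧
    Real.sin (15 / 2 * θ) = 15 * s - 560 * s ^ 3 + 6048 * s ^ 5 - 28800 * s ^ 7 + 70400 * s ^ 9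
      - 92160 * s ^ 11 + 61440 * s ^ 13 - 16384 * s ^ 15 := by
  have r := fun x => sin_add_three_halves_mul x θ
  rw [← hs] at r
  have e1 : Real.sin (3 / 2 * θ) = 3 * s - 4 * s ^ 3 := by
    rw [show 3 / 2 * θ = 3 * (θ / 2) by ring, Real.sin_three_mul, hs]
  have r0 := r 0
  have r1 := r 1
  have r2 := r 2
  have r3 := r 3
  have r4 := r 4
  have r5 := r 5
  norm_num at r0 r1 r2 r3 r4 r5
  rw [show 1 / 2 * θ = θ / 2 by ring, ← hs, e1] at r0
  rw [e1, r0] at r1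
  rw [r0, r1] at r2
  rw [r1, r2] at r3
  rw [r2, r3] at r4
  rw [r3, r4] at r5
  exact ⟨e1, r0.trans (by ring), r1.trans (by ring), r2.trans (by ring), r3.trans (by ring),
    r4.trans (by ring), r5.trans (by ring)⟩

/-- The polynomials in `s = sin(θ/2)` that bound `abelMinorant` from below are positive combinations
of products of powers of the distances from `s` to the ends of the interval. The decimals bound
`1/(1+γ)` from above and `1/((k+γ)(k+1+γ))` from below for `4.56 ≤ γ ≤ 4.57`. -/
theorem abelMinorant_poly_four_left {s : ℝ} (h1 : 239 / 1000 ≤ s) (h2 : s ≤ 1 / 2) :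
    0 ≤ 0.1799 * (s - 1)
      + 0.0273 * (1 + (3 * s - 4 * s ^ 3))
      + 0.0201 * (1 + (5 * s - 20 * s ^ 3 + 16 * s ^ 5))
      + 0.0154 * (1 + (7 * s - 56 * s ^ 3 + 112 * s ^ 5 - 64 * s ^ 7))
      + 0.0121 * (1 + (9 * s - 120 * s ^ 3 + 432 * s ^ 5 - 576 * s ^ 7 + 256 * s ^ 9)) := by
  have ha : 0 ≤ s - 239 / 1000 := by linarith
  have hb : 0 ≤ 1 / 2 - s := by linarith
  have h (i j : ℕ) : 0 ≤ (s - 239 / 1000) ^ i * (1 / 2 - s) ^ j := by positivity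
  linarith [h 0 9, h 1 8, h 2 7, h 3 6, h 4 5, h 5 4, h 6 3, h 7 2, h 8 1, h 9 0]

theorem abelMinorant_poly_four_right {s : ℝ} (h1 : 1 / 2 ≤ s) (h2 : s ≤ 1) :
    0 ≤ 0.1799 * (s - 1)
      + 0.0273 * (1 + (3 * s - 4 * s ^ 3))
      + 0.0201 * (1 + (5 * s - 20 * s ^ 3 + 16 * s ^ 5))
      + 0.0154 * (1 + (7 * s - 56 * s ^ 3 + 112 * s ^ 5 - 64 * s ^ 7))
      + 0.0121 * (1 + (9 * s - 120 * s ^ 3 + 432 * s ^ 5 - 576 * s ^ 7 + 256 * s ^ 9)) := by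
  have ha : 0 ≤ s - 1 / 2 := by linarith
  have hb : 0 ≤ 1 - s := by linarith
  have h (i j : ℕ) : 0 ≤ (s - 1 / 2) ^ i * (1 - s) ^ j := by positivity
  linarith [h 0 9, h 1 8, h 2 7, h 3 6, h 4 5, h 5 4, h 6 3, h 7 2, h 8 1, h 9 0]

theorem abelMinorant_poly_seven {s : ℝ} (h1 : 11 / 100 ≤ s) (h2 : s ≤ 6 / 25) :
    0 ≤ 0.1799 * (s - 1)
      + 0.0273 * (1 + (3 * s - 4 * s ^ 3))
      + 0.0201 * (1 + (5 * s - 20 * s ^ 3 + 16 * s ^ 5))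
      + 0.0154 * (1 + (7 * s - 56 * s ^ 3 + 112 * s ^ 5 - 64 * s ^ 7))
      + 0.0121 * (1 + (9 * s - 120 * s ^ 3 + 432 * s ^ 5 - 576 * s ^ 7 + 256 * s ^ 9))
      + 0.0098 * (1 + (11 * s - 220 * s ^ 3 + 1232 * s ^ 5 - 2816 * s ^ 7 + 2816 * s ^ 9
        - 1024 * s ^ 11))
      + 0.0081 * (1 + (13 * s - 364 * s ^ 3 + 2912 * s ^ 5 - 9984 * s ^ 7 + 16640 * s ^ 9
        - 13312 * s ^ 11 + 4096 * s ^ 13))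
      + 0.0068 * (1 + (15 * s - 560 * s ^ 3 + 6048 * s ^ 5 - 28800 * s ^ 7 + 70400 * s ^ 9
        - 92160 * s ^ 11 + 61440 * s ^ 13 - 16384 * s ^ 15)) := by
  have ha : 0 ≤ s - 11 / 100 := by linarith
  have hb : 0 ≤ 6 / 25 - s := by linarith
  have h (i j : ℕ) : 0 ≤ (s - 11 / 100) ^ i * (6 / 25 - s) ^ j := by positivity
  linarith [h 0 15, h 1 14, h 2 13, h 3 12, h 4 11, h 5 10, h 6 9, h 7 8, h 8 7, h 9 6,
    h 10 5, h 11 4, h 12 3, h 13 2, h 14 1, h 15 0]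

/-- A quotient with numerator `1 + t ≥ 0` decreases when the reciprocal of its denominator is
lowered to `d`. -/
theorem mul_one_add_le_div {γ t : ℝ} (h1 : 4.56 ≤ γ) (h2 : γ ≤ 4.57) (ht : -1 ≤ t) {i j d : ℝ}
    (hi : 0 ≤ i) (hj : 0 ≤ j) (hd : 0 ≤ d) (h : d * ((i + 4.57) * (j + 4.57)) ≤ 1) :
    d * (1 + t) ≤ (1 + t) / ((i + γ) * (j + γ)) := by
  rw [le_div_iff₀ (by positivity)]
  have : d * ((i + γ) * (j + γ)) ≤ 1 := le_trans (by gcongr) h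
  nlinarith

theorem abelMinorant_four_nonneg {γ θ : ℝ} (h1 : 4.56 ≤ γ) (h2 : γ ≤ 4.57)
    (hs : 239 / 1000 ≤ Real.sin (θ / 2)) : 0 ≤ abelMinorant γ 4 θ := by
  obtain ⟨s, hs'⟩ : ∃ s, s = Real.sin (θ / 2) := ⟨_, rfl⟩
  obtain ⟨e1, e2, e3, e4, -⟩ := sin_half_odd_mul θ hs'
  have hs1 := Real.sin_le_one (θ / 2)
  have hb := fun x => Real.neg_one_le_sin (x * θ)
  have c0 : 0.1799 * (s - 1) ≤ (s - 1) / (1 + γ) := by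
    rw [le_div_iff₀ (by linarith)]; nlinarith
  have c1 := mul_one_add_le_div h1 h2 (hb (3 / 2)) (i := 1) (j := 2) (d := 0.0273)
    (by norm_num) (by norm_num) (by norm_num) (by norm_num)
  have c2 := mul_one_add_le_div h1 h2 (hb (5 / 2)) (i := 2) (j := 3) (d := 0.0201)
    (by norm_num) (by norm_num) (by norm_num) (by norm_num)
  have c3 := mul_one_add_le_div h1 h2 (hb (7 / 2)) (i := 3) (j := 4) (d := 0.0154)
    (by norm_num) (by norm_num) (by norm_num) (by norm_num)
  have c4 := mul_one_add_le_div h1 h2 (hb (9 / 2)) (i := 4) (j := 5) (d := 0.0121)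
    (by norm_num) (by norm_num) (by norm_num) (by norm_num)
  simp only [abelMinorant, Finset.sum_range_succ, Finset.range_zero, Finset.sum_empty]
  norm_num
  rw [← hs'] at hs hs1 ⊢
  rw [e1] at c1 ⊢
  rw [e2] at c2 ⊢
  rw [e3] at c3 ⊢
  rw [e4] at c4 ⊢
  rcases le_total s (1 / 2) with h | h
  · linarith [abelMinorant_poly_four_left hs h]
  · linarith [abelMinorant_poly_four_right h hs1]

theorem abelMinorant_seven_nonneg {γ θ : ℝ} (h1 : 4.56 ≤ γ) (h2 : γ ≤ 4.57)
    (hs : 11 / 100 ≤ Real.sin (θ / 2)) (hs₂ : Real.sin (θ / 2) ≤ 6 / 25) :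
    0 ≤ abelMinorant γ 7 θ := by
  obtain ⟨s, hs'⟩ : ∃ s, s = Real.sin (θ / 2) := ⟨_, rfl⟩
  obtain ⟨e1, e2, e3, e4, e5, e6, e7⟩ := sin_half_odd_mul θ hs'
  have hb := fun x => Real.neg_one_le_sin (x * θ)
  have c0 : 0.1799 * (s - 1) ≤ (s - 1) / (1 + γ) := by
    rw [le_div_iff₀ (by linarith)]; nlinarith
  have c1 := mul_one_add_le_div h1 h2 (hb (3 / 2)) (i := 1) (j := 2) (d := 0.0273)
    (by norm_num) (by norm_num) (by norm_num) (by norm_num)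
  have c2 := mul_one_add_le_div h1 h2 (hb (5 / 2)) (i := 2) (j := 3) (d := 0.0201)
    (by norm_num) (by norm_num) (by norm_num) (by norm_num)
  have c3 := mul_one_add_le_div h1 h2 (hb (7 / 2)) (i := 3) (j := 4) (d := 0.0154)
    (by norm_num) (by norm_num) (by norm_num) (by norm_num)
  have c4 := mul_one_add_le_div h1 h2 (hb (9 / 2)) (i := 4) (j := 5) (d := 0.0121)
    (by norm_num) (by norm_num) (by norm_num) (by norm_num)
  have c5 := mul_one_add_le_div h1 h2 (hb (11 / 2)) (i := 5) (j := 6) (d := 0.0098)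
    (by norm_num) (by norm_num) (by norm_num) (by norm_num)
  have c6 := mul_one_add_le_div h1 h2 (hb (13 / 2)) (i := 6) (j := 7) (d := 0.0081)
    (by norm_num) (by norm_num) (by norm_num) (by norm_num)
  have c7 := mul_one_add_le_div h1 h2 (hb (15 / 2)) (i := 7) (j := 8) (d := 0.0068)
    (by norm_num) (by norm_num) (by norm_num) (by norm_num)
  simp only [abelMinorant, Finset.sum_range_succ, Finset.range_zero, Finset.sum_empty]
  norm_num
  rw [← hs'] at hs hs₂ ⊢
  rw [e1] at c1 ⊢
  rw [e2] at c2 ⊢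
  rw [e3] at c3 ⊢
  rw [e4] at c4 ⊢
  rw [e5] at c5 ⊢
  rw [e6] at c6 ⊢
  rw [e7] at c7 ⊢
  linarith [abelMinorant_poly_seven hs hs₂]

/-! ### Small angles -/

/-- The left side stays below `1/2`, while the right side increases with `q` and exceeds `1/2` from
`q = 9` on; for `q = 7, 8` the left side is at most `0.438`. -/
theorem small_angle_sum_bound {γ : ℝ} (h1 : 4.56 ≤ γ) (h2 : γ ≤ 4.57) {q : ℕ} (hq : 7 ≤ q) :
    (q + 1) / (2 * q + γ) ≤ 0.78 / (1 + γ) +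
      ∑ k ∈ Finset.range (q - 1), ((k : ℝ) + 3 / 2) / ((k + 1 + γ) * (k + 2 + γ)) := by
  have mono : ∀ {m : ℕ}, m ≤ q - 1 →
      ∑ k ∈ Finset.range m, ((k : ℝ) + 3 / 2) / ((k + 1 + γ) * (k + 2 + γ)) ≤
        ∑ k ∈ Finset.range (q - 1), ((k : ℝ) + 3 / 2) / ((k + 1 + γ) * (k + 2 + γ)) := fun hm =>
    Finset.sum_le_sum_of_subset_of_nonneg (Finset.range_mono hm)
      fun k _ _ => by positivity
  have c0 : 0.14 ≤ 0.78 / (1 + γ) := by rw [le_div_iff₀ (by linarith)]; linarith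
  have c (k : ℝ) (d : ℝ) (hk : 0 ≤ k) (hd : 0 ≤ d)
      (h : d * ((k + 5.57) * (k + 6.57)) ≤ k + 3 / 2) :
      d ≤ (k + 3 / 2) / ((k + 1 + γ) * (k + 2 + γ)) := by
    rw [le_div_iff₀ (by positivity)]
    refine le_trans ?_ h
    have h3 : k + 1 + γ ≤ k + 5.57 := by linarith
    have h4 : k + 2 + γ ≤ k + 6.57 := by linarith
    gcongr
  have c1 := c 0 0.0409 (by norm_num) (by norm_num) (by norm_num)
  have c2 := c 1 0.0502 (by norm_num) (by norm_num) (by norm_num)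
  have c3 := c 2 0.0539 (by norm_num) (by norm_num) (by norm_num)
  have c4 := c 3 0.0548 (by norm_num) (by norm_num) (by norm_num)
  have c5 := c 4 0.0543 (by norm_num) (by norm_num) (by norm_num)
  have c6 := c 5 0.0531 (by norm_num) (by norm_num) (by norm_num)
  have c7 := c 6 0.0515 (by norm_num) (by norm_num) (by norm_num)
  have c8 := c 7 0.0497 (by norm_num) (by norm_num) (by norm_num)
  have s6 := mono (m := 6) (by omega)
  rcases Nat.lt_or_ge q 9 with h | h
  · have : ((q : ℝ) + 1) / (2 * q + γ) ≤ 0.438 := by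
      have h9 : (q : ℝ) ≤ 8 := by exact_mod_cast Nat.le_of_lt_succ h
      rw [div_le_iff₀ (by positivity)]
      linarith
    simp only [Finset.sum_range_succ, Finset.range_zero, Finset.sum_empty] at s6
    push_cast at s6
    linarith
  · have s8 := mono (m := 8) (by omega)
    have : ((q : ℝ) + 1) / (2 * q + γ) ≤ 0.5 := by
      rw [div_le_iff₀ (by positivity)]
      linarith
    simp only [Finset.sum_range_succ, Finset.range_zero, Finset.sum_empty] at s8
    push_cast at s8
    linarith

/-- For a small angle `θ`, about `π/(2q)`, the sines below index `2q` are nonnegative and the first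
half of them satisfies Jordan's inequality `sin u ≥ 2u/π`. -/
theorem abelMinorant_nonneg_of_small {γ θ : ℝ} (h1 : 4.56 ≤ γ) (h2 : γ ≤ 4.57) {q : ℕ}
    (hq : 7 ≤ q) (hθ₁ : Real.pi ≤ 2 * (q + 1) * θ) (hθ₂ : 2 * q * θ ≤ Real.pi) :
    0 ≤ abelMinorant γ (2 * q - 1) θ := by
  have hq' : (7 : ℝ) ≤ q := by exact_mod_cast hq
  have hπ := Real.pi_gt_d2
  have hπ' := Real.pi_lt_d2
  have hθ : 0 < θ := by
    by_contra h
    have : 2 * (q + 1) * θ ≤ 0 := mul_nonpos_of_nonneg_of_nonpos (by positivity) (by linarith)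
    linarith
  have hθ3 : θ ≤ 0.225 := by nlinarith
  have hid := abelMinorant_add (γ := γ) (by linarith) (2 * q - 1) θ
  have hcast : ((2 * q - 1 : ℕ) : ℝ) = 2 * q - 1 := by
    rw [Nat.cast_sub (by omega)]; push_cast; ring
  rw [hcast, show (2 * (q : ℝ) - 1 + 1 + γ) = 2 * q + γ by ring] at hid
  have hs : 0.78 ≤ (q + 1) * Real.sin (θ / 2) := by
    have := Real.sin_gt_sub_cube (x := θ / 2) (by linarith)
    have hc : (θ / 2) ^ 3 ≤ 0.0127 * (θ / 2) := by nlinarith [sq_nonneg θ, mul_pos hθ hθ]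
    have : 0.9968 * (θ / 2) ≤ Real.sin (θ / 2) := by linarith
    have := mul_le_mul_of_nonneg_left this (by positivity : 0 ≤ (q : ℝ) + 1)
    linarith
  have hsplit : ∑ k ∈ Finset.range (q - 1), ((k : ℝ) + 3 / 2) / ((k + 1 + γ) * (k + 2 + γ)) ≤
      (q + 1) * ∑ k ∈ Finset.range (2 * q - 1),
        Real.sin ((k + 3 / 2) * θ) / ((k + 1 + γ) * (k + 2 + γ)) := by
    rw [Finset.mul_sum]
    calc _ ≤ ∑ k ∈ Finset.range (q - 1), (q + 1) *
          (Real.sin ((k + 3 / 2) * θ) / ((k + 1 + γ) * (k + 2 + γ))) := ?_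
      _ ≤ _ := Finset.sum_le_sum_of_subset_of_nonneg (Finset.range_mono (by omega)) ?_
    · refine Finset.sum_le_sum fun k hk => ?_
      have hk' : (k : ℝ) + 2 ≤ q := by
        have := Finset.mem_range.mp hk
        exact_mod_cast (by omega : k + 2 ≤ q)
      rw [mul_div_assoc']
      gcongr
      have hu : ((k : ℝ) + 3 / 2) * θ ≤ Real.pi / 2 := by nlinarith
      have hJ := Real.mul_le_sin (x := ((k : ℝ) + 3 / 2) * θ) (by positivity) hu
      calc (k : ℝ) + 3 / 2 = (q + 1) * (2 / Real.pi * ((k + 3 / 2) * (Real.pi / (2 * (q + 1))))) := by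
            field_simp
        _ ≤ (q + 1) * (2 / Real.pi * ((k + 3 / 2) * θ)) := by
            gcongr
            rw [div_le_iff₀ (by positivity)]
            linarith
        _ ≤ _ := by gcongr
    · intro k hk _
      have hk' : (k : ℝ) + 2 ≤ 2 * q := by
        have := Finset.mem_range.mp hk
        exact_mod_cast (by omega : k + 2 ≤ 2 * q)
      have : 0 ≤ Real.sin ((k + 3 / 2) * θ) :=
        Real.sin_nonneg_of_nonneg_of_le_pi (by positivity) (by nlinarith)
      positivity
  have hb := small_angle_sum_bound h1 h2 hq
  have hq1 : 0 < (q : ℝ) + 1 := by positivity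
  have hs' : 0.78 / (1 + γ) ≤ (q + 1) * Real.sin (θ / 2) / (1 + γ) := by gcongr
  refine nonneg_of_mul_nonneg_right (a := (q : ℝ) + 1) ?_ hq1
  have : ((q : ℝ) + 1) * abelMinorant γ (2 * q - 1) θ = (q + 1) * Real.sin (θ / 2) / (1 + γ) +
      (q + 1) * ∑ k ∈ Finset.range (2 * q - 1),
        Real.sin ((k + 3 / 2) * θ) / ((k + 1 + γ) * (k + 2 + γ)) - (q + 1) / (2 * q + γ) := by
    linear_combination ((q : ℝ) + 1) * hid
  linarith

/-! ### Cosine sums with at most three cosines -/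

theorem cosineSum_one_nonneg {γ : ℝ} (hγ : -1 < γ) (θ : ℝ) : 0 ≤ cosineSum γ 1 θ := by
  have : cosineSum γ 1 θ = (1 + Real.cos θ) / (1 + γ) := by
    simp [cosineSum]
    ring
  rw [this]
  exact div_nonneg (by linarith [Real.neg_one_le_cos θ]) (by linarith)

theorem cosineSum_two_nonneg {γ : ℝ} (h0 : 0 ≤ γ) (h1 : γ ≤ 4.57) (θ : ℝ) :
    0 ≤ cosineSum γ 2 θ := by
  have e : cosineSum γ 2 θ = (2 * (1 + γ) * Real.cos θ ^ 2 + (2 + γ) * Real.cos θ + 1) /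
      ((1 + γ) * (2 + γ)) := by
    simp only [cosineSum, Finset.sum_range_succ, Finset.range_zero, Finset.sum_empty]
    norm_num
    rw [Real.cos_two_mul]
    field_simp
    ring
  rw [e]
  refine div_nonneg ?_ (by positivity)
  -- the discriminant `γ² - 4γ - 4` of the quadratic in `cos θ` is negative
  nlinarith [sq_nonneg (4 * (1 + γ) * Real.cos θ + (2 + γ))]

/-- At the root `γ` of the septic the discriminant of the cubic in `cos θ` vanishes, so the cubic
has a double root. The third root lies to the left of `-1`. -/
theorem cosineSum_three_nonneg {γ : ℝ} (h0 : 4.5678 ≤ γ) (h1 : γ ≤ 4.5679) (hs : septic γ = 0)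
    (θ : ℝ) : 0 ≤ cosineSum γ 3 θ := by
  obtain ⟨x, hx⟩ : ∃ x, x = Real.cos θ := ⟨_, rfl⟩
  have hx1 : -1 ≤ x := hx ▸ Real.neg_one_le_cos θ
  obtain ⟨a, ha⟩ : ∃ a, a = 4 * (1 + γ) * (2 + γ) := ⟨_, rfl⟩
  obtain ⟨b, hb⟩ : ∃ b, b = 2 * (1 + γ) * (3 + γ) := ⟨_, rfl⟩
  obtain ⟨c, hc⟩ : ∃ c, c = -2 * γ * (2 + γ) := ⟨_, rfl⟩
  obtain ⟨d, hd⟩ : ∃ d, d = 3 + γ := ⟨_, rfl⟩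
  have e : cosineSum γ 3 θ = (a * x ^ 3 + b * x ^ 2 + c * x + d) /
      ((1 + γ) * (2 + γ) * (3 + γ)) := by
    simp only [cosineSum, Finset.sum_range_succ, Finset.range_zero, Finset.sum_empty]
    norm_num
    rw [Real.cos_two_mul, Real.cos_three_mul, ← hx, ha, hb, hc, hd]
    field_simp
    ring
  rw [e]
  refine div_nonneg ?_ (by positivity)
  have hdisc : b ^ 2 * c ^ 2 - 4 * a * c ^ 3 - 4 * b ^ 3 * d - 27 * a ^ 2 * d ^ 2
      + 18 * a * b * c * d = 0 := by
    have : b ^ 2 * c ^ 2 - 4 * a * c ^ 3 - 4 * b ^ 3 * d - 27 * a ^ 2 * d ^ 2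
        + 18 * a * b * c * d = 16 * (1 + γ) * septic γ := by
      rw [ha, hb, hc, hd, septic]; ring
    rw [this, hs, mul_zero]
  obtain ⟨D, hD⟩ : ∃ D, D = b ^ 2 - 3 * a * c := ⟨_, rfl⟩
  obtain ⟨N, hN⟩ : ∃ N, N = 9 * a * d - b * c := ⟨_, rfl⟩
  -- the double root is `N / (2 D)`
  have key : 4 * D ^ 3 * (a * x ^ 3 + b * x ^ 2 + c * x + d) =
      (2 * D * x - N) ^ 2 * (a * D * x + a * N + b * D) := by
    rw [hD, hN]
    linear_combination (-9 * a * (b ^ 2 - 3 * a * c) * x - b * (b ^ 2 - 3 * a * c)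
      + 3 * a * (9 * a * d - b * c)) * hdisc
  have hapos : 0 < a := by rw [ha]; positivity
  have hcneg : c ≤ 0 := by rw [hc]; nlinarith
  have hDpos : 0 < D := by
    have : 0 < b := by rw [hb]; positivity
    rw [hD]
    nlinarith [mul_nonneg hapos.le (neg_nonneg.mpr hcneg), pow_pos this 2]
  have hlin : 0 ≤ a * D * x + a * N + b * D := by
    have hD' : D ≤ 34000 := by
      calc D = 4 * (1 + γ) ^ 2 * (3 + γ) ^ 2 + 24 * γ * (1 + γ) * (2 + γ) ^ 2 := by
            rw [hD, ha, hb, hc]; ring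
        _ ≤ 4 * (1 + 4.57) ^ 2 * (3 + 4.57) ^ 2 + 24 * 4.57 * (1 + 4.57) * (2 + 4.57) ^ 2 := by
            gcongr <;> linarith
        _ ≤ 34000 := by norm_num
    have hE : 34000 ≤ 8 * (2 + γ) ^ 2 * (3 + γ) * (9 + γ) := by
      calc (34000 : ℝ) ≤ 8 * (2 + 4.56) ^ 2 * (3 + 4.56) * (9 + 4.56) := by norm_num
        _ ≤ _ := by gcongr <;> linarith
    have : a * N + b * D - a * D =
        2 * (1 + γ) ^ 2 * (8 * (2 + γ) ^ 2 * (3 + γ) * (9 + γ) - D) := by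
      rw [hN, ha, hb, hc, hd]; ring
    have : a * D ≤ a * N + b * D := by
      have : 0 ≤ 2 * (1 + γ) ^ 2 * (8 * (2 + γ) ^ 2 * (3 + γ) * (9 + γ) - D) :=
        mul_nonneg (by positivity) (by linarith)
      linarith
    nlinarith [mul_pos hapos hDpos]
  refine nonneg_of_mul_nonneg_right (a := 4 * D ^ 3) ?_ (by positivity)
  rw [key]
  positivity

/-! ### Nonnegativity of the cosine sums -/

theorem cosineSum_congr {θ θ' : ℝ} (h : Real.cos θ = Real.cos θ') (γ : ℝ) (l : ℕ) :
    cosineSum γ l θ = cosineSum γ l θ' := by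
  have : ∀ k : ℕ, Real.cos ((k + 1) * θ) = Real.cos ((k + 1) * θ') := by
    intro k
    have h1 := Polynomial.Chebyshev.T_real_cos θ (k + 1)
    have h2 := Polynomial.Chebyshev.T_real_cos θ' (k + 1)
    push_cast at h1 h2
    rw [← h1, ← h2, h]
  simp only [cosineSum, this]

theorem cosineSum_gasperConstant_nonneg_of_small {θ : ℝ} (hθ : 0 < θ) (hθ' : 14 * θ ≤ Real.pi)
    (l : ℕ) : 0 ≤ cosineSum gasperConstant l θ := by
  obtain ⟨hA, hA'⟩ := gasperConstant_mem
  have hπ := Real.pi_pos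
  set q := ⌊Real.pi / (2 * θ)⌋₊
  have hq1 : (q : ℝ) ≤ Real.pi / (2 * θ) := Nat.floor_le (by positivity)
  have hq2 : Real.pi / (2 * θ) < q + 1 := Nat.lt_floor_add_one _
  have hq : 7 ≤ q := Nat.le_floor (by rw [le_div_iff₀ (by positivity)]; push_cast; linarith)
  rw [le_div_iff₀ (by positivity)] at hq1
  rw [div_lt_iff₀ (by positivity)] at hq2
  rcases Nat.lt_or_ge l (2 * q - 1) with h | h
  · refine cosineSum_nonneg_of_mul_le_pi (by linarith) hθ (by linarith) ?_
    have : (l : ℝ) + 2 ≤ 2 * q := by exact_mod_cast (by omega : l + 2 ≤ 2 * q)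
    nlinarith
  · exact cosineSum_nonneg_of_abelMinorant_nonneg (by linarith)
      (Real.sin_pos_of_pos_of_lt_pi (by linarith) (by linarith))
      (abelMinorant_nonneg_of_small (by linarith) (by linarith) hq (by linarith) (by linarith)) h

theorem cosineSum_gasperConstant_nonneg (l : ℕ) (θ : ℝ) : 0 ≤ cosineSum gasperConstant l θ := by
  obtain ⟨hA, hA'⟩ := gasperConstant_mem
  have hseptic : septic gasperConstant = 0 := existsUnique_septic_root.choose_spec.1.2
  -- the sum depends on `cos θ` only, so `θ` may be replaced by `arccos (cos θ)`
  wlog hI : 0 ≤ θ ∧ θ ≤ Real.pi generalizing θ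
  · rw [← cosineSum_congr (Real.cos_arccos (Real.neg_one_le_cos θ) (Real.cos_le_one θ))]
    exact this _ ⟨Real.arccos_nonneg _, Real.arccos_le_pi _⟩
  obtain ⟨hθ0, hθπ⟩ := hI
  rcases hθ0.eq_or_lt with rfl | hθ
  · simp only [cosineSum, mul_zero, Real.cos_zero]
    positivity
  have hπ := Real.pi_gt_d4
  have hs : 0 < Real.sin (θ / 2) := Real.sin_pos_of_pos_of_lt_pi (by linarith) (by linarith)
  have hsin_ge : ∀ x : ℝ, 0 < x → x ≤ θ / 2 → x - x ^ 3 / 6 < Real.sin (θ / 2) := fun x hx hxθ =>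
    (Real.sin_gt_sub_cube hx).trans_le
      (Real.sin_le_sin_of_le_of_le_pi_div_two (by linarith) (by linarith) hxθ)
  rcases le_or_gt (239 / 1000) (Real.sin (θ / 2)) with h1 | h1
  · rcases Nat.lt_or_ge l 4 with h | h
    · interval_cases l
      · simp only [cosineSum, Finset.range_zero, Finset.sum_empty]
        positivity
      · exact cosineSum_one_nonneg (by linarith) θ
      · exact cosineSum_two_nonneg (by linarith) (by linarith) θ
      · exact cosineSum_three_nonneg (by linarith) (by linarith) hseptic θ
    · exact cosineSum_nonneg_of_abelMinorant_nonneg (by linarith) hs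
        (abelMinorant_four_nonneg (by linarith) (by linarith) h1) h
  rcases le_or_gt (11 / 100) (Real.sin (θ / 2)) with h2 | h2
  · rcases Nat.lt_or_ge l 7 with h | h
    · refine cosineSum_nonneg_of_mul_le_pi (by linarith) hθ (by linarith) ?_
      have hl : (l : ℝ) ≤ 6 := by exact_mod_cast Nat.le_of_lt_succ h
      have : θ / 2 < 0.24165 := by
        by_contra! hc
        have := hsin_ge 0.24165 (by norm_num) hc
        norm_num at this
        linarith
      nlinarith
    · exact cosineSum_nonneg_of_abelMinorant_nonneg (by linarith) hs
        (abelMinorant_seven_nonneg (by linarith) (by linarith) h2 (by linarith)) h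
  · refine cosineSum_gasperConstant_nonneg_of_small hθ ?_ l
    have : θ / 2 < 0.112 := by
      by_contra! hc
      have := hsin_ge 0.112 (by norm_num) hc
      norm_num at this
      linarith
    linarith

/-- Gasper's theorem: the cosine sums stay nonnegative for every `γ` up to the constant, since the
quotients `(k+A)/(k+γ)` decrease with `k` when `γ ≤ A`. -/
theorem cosineSum_nonneg {γ : ℝ} (h0 : -1 < γ) (hγ : γ ≤ gasperConstant) (l : ℕ) (θ : ℝ) :
    0 ≤ cosineSum γ l θ := by
  have hA : -1 < gasperConstant := h0.trans_le hγ
  have hpos : ∀ {δ : ℝ}, -1 < δ → ∀ k : ℕ, 0 < (k : ℝ) + 1 + δ := fun hδ k => by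
    linarith [(Nat.cast_nonneg k : (0 : ℝ) ≤ k)]
  have hw : Antitone fun k : ℕ => ((k : ℝ) + 1 + gasperConstant) / (k + 1 + γ) := by
    refine antitone_nat_of_succ_le fun k => ?_
    have h1 := hpos h0 k
    have h2 := hpos h0 (k + 1)
    rw [div_le_div_iff₀ h2 h1]
    push_cast
    nlinarith
  have := weighted_sum_nonneg hw (fun k => (div_pos (hpos hA k) (hpos h0 k)).le)
    (fun l => cosineSum_gasperConstant_nonneg l θ) l
  convert this using 1
  rw [cosineSum]
  congr 1
  · have h1 := hpos h0 0
    have h2 := hpos hA 0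
    simp only [Nat.cast_zero, zero_add] at h1 h2 ⊢
    field_simp
  · refine Finset.sum_congr rfl fun k _ => ?_
    have h1 := (hpos h0 k).ne'
    have h2 := (hpos hA k).ne'
    field_simp

/-- The complex form of Gasper's theorem inside the unit disk, with the gain that comes from
damping the `k`-th term by `‖w‖ ^ k`. -/
theorem re_sum_pow_div_ge {γ : ℝ} (h0 : -1 < γ) (hγ : γ ≤ gasperConstant) (l : ℕ) {w : ℂ}
    (hw : ‖w‖ ≤ 1) :
    -(‖w‖ / (1 + γ)) ≤ ∑ k ∈ Finset.range l, (w ^ (k + 1)).re / (k + 1 + γ) := by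
  have hw' : Antitone fun k : ℕ => ‖w‖ ^ (k + 1) := fun i j hij =>
    pow_le_pow_of_le_one (norm_nonneg w) hw (by omega)
  have := weighted_sum_nonneg hw' (fun k => by positivity)
    (fun l => cosineSum_nonneg h0 hγ l w.arg) l
  have e : ∀ k : ℕ, (w ^ (k + 1)).re = ‖w‖ ^ (k + 1) * Real.cos ((k + 1) * w.arg) := by
    intro k
    conv_lhs => rw [← Complex.norm_mul_exp_arg_mul_I w, mul_pow, ← Complex.exp_nat_mul]
    rw [← Complex.ofReal_pow, Complex.re_ofReal_mul, ← mul_assoc, ← Complex.ofReal_natCast,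
      ← Complex.ofReal_mul, Complex.exp_ofReal_mul_I_re]
    push_cast
    rfl
  simp only [e, mul_div_assoc]
  simp only [zero_add, pow_one, mul_one_div] at this
  linarith

/-! ### Convolution with functions of positive real part -/

theorem powCoeff_succ (p : ℂ → ℂ) (k : ℕ) :
    powCoeff p (k + 1) = iteratedDeriv k p 0 / (k.factorial : ℂ) := rfl

theorem circleAverage_mul_inv_pow {p : ℂ → ℂ} (hp : DifferentiableOn ℂ p (Metric.ball 0 1))
    {r : ℝ} (hr0 : 0 < r) (hr1 : r < 1) (k : ℕ) :
    Real.circleAverage (fun ζ => p ζ * ζ⁻¹ ^ k) 0 r = powCoeff p (k + 1) := by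
  lift r to NNReal using hr0.le
  have h1 := (hp.mono (Metric.closedBall_subset_ball hr1)).hasFPowerSeriesOnBall
    (by exact_mod_cast hr0)
  have h2 := h1.factorial_smul 1 k
  rw [cauchyPowerSeries_apply, ← iteratedDeriv_eq_iteratedFDeriv] at h2
  rw [powCoeff_succ, ← h2, Real.circleAverage_eq_circleIntegral hr0.ne']
  have hk : (k.factorial : ℂ) ≠ 0 := by exact_mod_cast k.factorial_ne_zero
  rw [nsmul_eq_mul, mul_div_cancel_left₀ _ hk]
  congr 1
  refine circleIntegral.integral_congr hr0.le fun ζ _ => ?_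
  simp only [sub_zero, smul_eq_mul, one_div]
  ring

/-- If `Re p ≥ 0` and the real trigonometric sum with coefficients `c k` is at least `-M` on the
circle of radius `‖z‖ / r`, then the Hadamard product of this sum with `p` has real part at least
`-2 M Re p(0)`. -/
theorem neg_two_mul_le_re_sum_powCoeff {p : ℂ → ℂ}
    (hp : DifferentiableOn ℂ p (Metric.ball 0 1)) (hre : ∀ z : ℂ, ‖z‖ < 1 → 0 ≤ (p z).re)
    (c : ℕ → ℝ) (l : ℕ) {z : ℂ} {r M : ℝ} (hr0 : 0 < r) (hr1 : r < 1)
    (hM : ∀ w : ℂ, ‖w‖ = ‖z‖ / r → -M ≤ ∑ k ∈ Finset.range l, c k * (w ^ (k + 1)).re) :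
    -(2 * M * (p 0).re) ≤
      (∑ k ∈ Finset.range l, (c k : ℂ) * powCoeff p (k + 2) * z ^ (k + 1)).re := by
  have hball : Metric.closedBall (0 : ℂ) r ⊆ Metric.ball 0 1 := Metric.closedBall_subset_ball hr1
  have hsphere : ∀ ζ ∈ Metric.sphere (0 : ℂ) |r|, ‖ζ‖ = r ∧ ζ ≠ 0 := fun ζ hζ => by
    rw [abs_of_pos hr0, mem_sphere_zero_iff_norm] at hζ
    exact ⟨hζ, norm_pos_iff.mp (hζ ▸ hr0)⟩
  have hpc : ContinuousOn p (Metric.sphere 0 |r|) := hp.continuousOn.mono fun ζ hζ => hball (by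
    rw [mem_closedBall_zero_iff, (hsphere ζ hζ).1])
  have hinv : ContinuousOn (fun ζ : ℂ => ζ⁻¹) (Metric.sphere 0 |r|) :=
    continuousOn_inv₀.mono fun ζ hζ => (hsphere ζ hζ).2
  set K : ℂ → ℂ := fun ζ => ∑ k ∈ Finset.range l, (c k : ℂ) * z ^ (k + 1) * ζ⁻¹ ^ (k + 1)
  -- on the circle this polynomial is the conjugate of `K`
  set K' : ℂ → ℂ := fun ζ => ∑ k ∈ Finset.range l,
    (c k : ℂ) * (starRingEnd ℂ z / r ^ 2) ^ (k + 1) * ζ ^ (k + 1)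
  have hKc : ContinuousOn K (Metric.sphere 0 |r|) := by fun_prop
  have hK'c : Continuous K' := by fun_prop
  have h1 : Real.circleAverage (fun ζ => p ζ * K ζ) 0 r =
      ∑ k ∈ Finset.range l, (c k : ℂ) * powCoeff p (k + 2) * z ^ (k + 1) := by
    have e : (fun ζ => p ζ * K ζ) = ∑ k ∈ Finset.range l,
        (((c k : ℂ) * z ^ (k + 1)) • fun ζ => p ζ * ζ⁻¹ ^ (k + 1)) := by
      ext ζ
      simp only [K, Finset.mul_sum, Finset.sum_apply, Pi.smul_apply, smul_eq_mul]
      exact Finset.sum_congr rfl fun k _ => by ring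
    have hci : ∀ k : ℕ, CircleIntegrable (fun ζ => p ζ * ζ⁻¹ ^ (k + 1)) 0 r := fun k =>
      ContinuousOn.circleIntegrable' (hpc.mul (hinv.pow _))
    rw [e, Real.circleAverage_sum fun k _ => (hci k).const_smul]
    refine Finset.sum_congr rfl fun k _ => ?_
    rw [Real.circleAverage_smul, circleAverage_mul_inv_pow hp hr0 hr1, smul_eq_mul]
    ring
  have h2 : Real.circleAverage (fun ζ => p ζ * K' ζ) 0 r = 0 := by
    have hd : DiffContOnCl ℂ (fun ζ => p ζ * K' ζ) (Metric.ball 0 |r|) := by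
      rw [abs_of_pos hr0]
      refine DifferentiableOn.diffContOnCl ?_
      rw [closure_ball _ hr0.ne']
      exact (hp.mono hball).mul (Differentiable.differentiableOn (by fun_prop))
    rw [hd.circleAverage]
    simp [K']
  have hconj : ∀ ζ ∈ Metric.sphere (0 : ℂ) |r|,
      K ζ + K' ζ = ((2 * ∑ k ∈ Finset.range l, c k * ((z / ζ) ^ (k + 1)).re : ℝ) : ℂ) := by
    intro ζ hζ
    obtain ⟨hn, h0⟩ := hsphere ζ hζ
    have hK : K ζ = ∑ k ∈ Finset.range l, (c k : ℂ) * (z / ζ) ^ (k + 1) :=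
      Finset.sum_congr rfl fun k _ => by rw [div_eq_mul_inv, mul_pow, mul_assoc]
    have hK' : K' ζ = starRingEnd ℂ (K ζ) := by
      rw [hK, map_sum]
      refine Finset.sum_congr rfl fun k _ => ?_
      have : starRingEnd ℂ z / r ^ 2 * ζ = starRingEnd ℂ (z / ζ) := by
        have h3 : (r : ℂ) ^ 2 = ζ * starRingEnd ℂ ζ := by rw [Complex.mul_conj', hn]
        have h4 : starRingEnd ℂ ζ ≠ 0 := by simpa using h0
        rw [h3, map_div₀]
        field_simp
      rw [mul_assoc, ← mul_pow, this, map_mul, map_pow, Complex.conj_ofReal]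
    rw [hK', Complex.add_conj, hK, Complex.re_sum]
    simp only [Complex.re_ofReal_mul]
  have hint : CircleIntegrable (fun ζ => p ζ * (K ζ + K' ζ)) 0 r :=
    ContinuousOn.circleIntegrable' (hpc.mul (hKc.add hK'c.continuousOn))
  have h3 : (∑ k ∈ Finset.range l, (c k : ℂ) * powCoeff p (k + 2) * z ^ (k + 1)).re =
      Real.circleAverage (fun ζ => (p ζ * (K ζ + K' ζ)).re) 0 r := by
    have h4 := Complex.reCLM.circleAverage_comp_comm hint
    have h5 : Real.circleAverage (fun ζ => p ζ * (K ζ + K' ζ)) 0 r =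
        Real.circleAverage (fun ζ => p ζ * K ζ) 0 r +
          Real.circleAverage (fun ζ => p ζ * K' ζ) 0 r := by
      have hi : CircleIntegrable (fun ζ => p ζ * K ζ) 0 r :=
        ContinuousOn.circleIntegrable' (hpc.mul hKc)
      have hi' : CircleIntegrable (fun ζ => p ζ * K' ζ) 0 r :=
        ContinuousOn.circleIntegrable' (hpc.mul hK'c.continuousOn)
      rw [← Real.circleAverage_fun_add hi hi']
      simp only [mul_add]
    rw [h5, h1, h2, add_zero] at h4
    exact h4.symm
  have hpi : CircleIntegrable p 0 r := ContinuousOn.circleIntegrable' hpc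
  have h6 : Real.circleAverage (fun ζ => (-(2 * M)) • (p ζ).re) 0 r = -(2 * M * (p 0).re) := by
    have h7 := Complex.reCLM.circleAverage_comp_comm hpi
    have hd : DiffContOnCl ℂ p (Metric.ball 0 |r|) := by
      rw [abs_of_pos hr0]
      refine DifferentiableOn.diffContOnCl ?_
      rw [closure_ball _ hr0.ne']
      exact hp.mono hball
    rw [hd.circleAverage] at h7
    have h8 := Real.circleAverage_fun_smul (a := -(2 * M)) (f := fun ζ => (p ζ).re) (c := 0) (R := r)
    rw [h8]
    have h9 : Real.circleAverage (fun ζ => (p ζ).re) 0 r = (p 0).re := h7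
    rw [h9, smul_eq_mul]
    ring
  rw [h3, ← h6]
  have hpr : ContinuousOn (fun ζ => (p ζ).re) (Metric.sphere 0 |r|) :=
    Complex.continuous_re.comp_continuousOn hpc
  refine Real.circleAverage_mono (ContinuousOn.circleIntegrable' (hpr.fun_const_smul _))
    (ContinuousOn.circleIntegrable' (Complex.continuous_re.comp_continuousOn
      (hpc.mul (hKc.add hK'c.continuousOn)))) fun ζ hζ => ?_
  obtain ⟨hn, h0⟩ := hsphere ζ hζ
  have h10 := hM (z / ζ) (by rw [norm_div, hn])
  have h11 := hre ζ (hn ▸ hr1)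
  simp only [hconj ζ hζ, Complex.re_mul_ofReal, smul_eq_mul]
  nlinarith

/-! ### The Salagean operator on power quotients -/

/-- The Salagean operator seen on the factor `g` of `z^α g(z)`, normalized by `α`:
`D(z^α g) = α z^α (g + z g' / α)`. -/
noncomputable def reducedSalagean (α : ℝ) (g : ℂ → ℂ) (z : ℂ) : ℂ := g z + z * deriv g z / α

theorem differentiableOn_reducedSalagean {g : ℂ → ℂ} (α : ℝ)
    (hg : DifferentiableOn ℂ g (Metric.ball 0 1)) :
    DifferentiableOn ℂ (reducedSalagean α g) (Metric.ball 0 1) := by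
  have := hg.deriv Metric.isOpen_ball
  unfold reducedSalagean
  fun_prop

theorem differentiableOn_iterate_reducedSalagean {g : ℂ → ℂ} (α : ℝ)
    (hg : DifferentiableOn ℂ g (Metric.ball 0 1)) (n : ℕ) :
    DifferentiableOn ℂ ((reducedSalagean α)^[n] g) (Metric.ball 0 1) := by
  induction n with
  | zero => exact hg
  | succ n ih =>
    rw [Function.iterate_succ_apply']
    exact differentiableOn_reducedSalagean α ih

theorem iterate_reducedSalagean_apply_zero (α : ℝ) (g : ℂ → ℂ) (n : ℕ) :
    (reducedSalagean α)^[n] g 0 = g 0 := by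
  induction n with
  | zero => rfl
  | succ n ih =>
    rw [Function.iterate_succ_apply', reducedSalagean, zero_mul, zero_div, add_zero, ih]

theorem iterate_salagean_branchPow_mul {α : ℝ} (hα : 0 < α) {g : ℂ → ℂ}
    (hg : DifferentiableOn ℂ g (Metric.ball 0 1)) {z : ℂ} (hz : ‖z‖ < 1) (hz0 : z ≠ 0) (n : ℕ) :
    salagean^[n] (fun ζ => branchPow α z ζ * g ζ) =ᶠ[𝓝 z]
      fun ζ => (α : ℂ) ^ n * (branchPow α z ζ * (reducedSalagean α)^[n] g ζ) := by
  have hα' : (α : ℂ) ≠ 0 := by exact_mod_cast hα.ne'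
  induction n with
  | zero => simp
  | succ n ih =>
    have hslit : ∀ᶠ ζ in 𝓝 z, ζ / z ∈ Complex.slitPlane := by
      have hc : ContinuousAt (fun ζ : ℂ => ζ / z) z := by fun_prop
      refine hc.eventually_mem (Complex.isOpen_slitPlane.mem_nhds ?_)
      rw [div_self hz0]
      exact Complex.one_mem_slitPlane
    have hball : ∀ᶠ ζ in 𝓝 z, ζ ∈ Metric.ball (0 : ℂ) 1 :=
      Metric.isOpen_ball.mem_nhds (mem_ball_zero_iff.mpr hz)
    filter_upwards [ih.eventuallyEq_nhds, hslit, hball, eventually_ne_nhds hz0]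
      with ζ h1 h2 h3 h4
    rw [Function.iterate_succ_apply', Function.iterate_succ_apply', salagean, h1.deriv_eq]
    set G := (reducedSalagean α)^[n] g
    have hG : HasDerivAt G (deriv G ζ) ζ :=
      ((differentiableOn_iterate_reducedSalagean α hg n).differentiableAt
        (Metric.isOpen_ball.mem_nhds h3)).hasDerivAt
    have hb : HasDerivAt (branchPow α z)
        (z ^ (α : ℂ) * (α * (ζ / z) ^ ((α : ℂ) - 1) * (1 / z))) ζ :=
      (((hasDerivAt_id ζ).div_const z).cpow_const h2).const_mul _
    have hpow : ζ * (z ^ (α : ℂ) * (α * (ζ / z) ^ ((α : ℂ) - 1) * (1 / z))) =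
        α * branchPow α z ζ := by
      have h5 : ζ / z ≠ 0 := div_ne_zero h4 hz0
      rw [branchPow, Complex.cpow_sub _ _ h5, Complex.cpow_one]
      field_simp
    rw [((hb.fun_mul hG).const_mul ((α : ℂ) ^ n)).deriv, reducedSalagean]
    have h6 : (α : ℂ) * (G ζ + ζ * deriv G ζ / α) = α * G ζ + ζ * deriv G ζ := by
      field_simp
    rw [pow_succ]
    linear_combination (α : ℂ) ^ n * G ζ * hpow - (α : ℂ) ^ n * branchPow α z ζ * h6

theorem salageanQuotient_eq {α : ℝ} (hα : 0 < α) {g : ℂ → ℂ}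
    (hg : DifferentiableOn ℂ g (Metric.ball 0 1)) (n : ℕ) {z : ℂ} (hz : ‖z‖ < 1) (hz0 : z ≠ 0) :
    salageanQuotient n α g z = (reducedSalagean α)^[n] g z := by
  have hα' : (α : ℂ) ≠ 0 := by exact_mod_cast hα.ne'
  have hp : z ^ (α : ℂ) ≠ 0 := by simp [Complex.cpow_eq_zero_iff, hz0]
  have hb : branchPow α z z = z ^ (α : ℂ) := by
    rw [branchPow, div_self hz0, Complex.one_cpow, mul_one]
  rw [salageanQuotient, (iterate_salagean_branchPow_mul hα hg hz hz0 n).self_of_nhds]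
  simp only [hb]
  field_simp

theorem iteratedDeriv_id_mul_deriv {g : ℂ → ℂ} (hg : AnalyticAt ℂ g 0) (k : ℕ) :
    iteratedDeriv k (fun z => z * deriv g z) 0 = k * iteratedDeriv k g 0 := by
  induction k generalizing g with
  | zero => simp
  | succ k ih =>
    have e : deriv (fun z => z * deriv g z) =ᶠ[𝓝 0]
        deriv g + fun z => z * deriv (deriv g) z := by
      filter_upwards [hg.eventually_analyticAt] with z hz
      have := (hasDerivAt_id' z).fun_mul hz.deriv.differentiableAt.hasDerivAt
      rw [this.deriv, Pi.add_apply, one_mul]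
    have h1 : ContDiffAt ℂ k (deriv g) 0 := hg.deriv.contDiffAt
    have h2 : ContDiffAt ℂ k (fun z => z * deriv (deriv g) z) 0 :=
      contDiffAt_id.mul hg.deriv.deriv.contDiffAt
    rw [iteratedDeriv_succ', iteratedDeriv_succ', e.iteratedDeriv_eq, iteratedDeriv_add h1 h2,
      ih hg.deriv]
    push_cast
    ring

theorem powCoeff_reducedSalagean (α : ℝ) {g : ℂ → ℂ} (hg : AnalyticAt ℂ g 0) (k : ℕ) :
    powCoeff (reducedSalagean α g) (k + 1) = (1 + k / α) * powCoeff g (k + 1) := by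
  have e : reducedSalagean α g = g + fun z => (α : ℂ)⁻¹ * (z * deriv g z) := by
    ext z
    rw [reducedSalagean, Pi.add_apply]
    ring
  have h2 : ContDiffAt ℂ k (fun z => z * deriv g z) 0 :=
    contDiffAt_id.mul hg.deriv.contDiffAt
  have h3 : ContDiffAt ℂ k (fun z => (α : ℂ)⁻¹ * (z * deriv g z)) 0 := contDiffAt_const.mul h2
  rw [powCoeff_succ, powCoeff_succ, e, iteratedDeriv_add hg.contDiffAt h3,
    iteratedDeriv_const_mul_field, iteratedDeriv_id_mul_deriv hg]
  ring

theorem quasiPartialQuotient_eq_sum_range (α c : ℝ) (g : ℂ → ℂ) (m : ℕ) (z : ℂ) :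
    quasiPartialQuotient α c g m z = 1 + ∑ k ∈ Finset.range (m - 1),
      (((α + c) / (k + 1 + (α + c)) : ℝ) : ℂ) * powCoeff g (k + 2) * z ^ (k + 1) := by
  rw [quasiPartialQuotient, ← Finset.Ico_add_one_right_eq_Icc, Finset.sum_Ico_eq_sum_range,
    show m + 1 - 2 = m - 1 by omega]
  congr 1
  refine Finset.sum_congr rfl fun k _ => ?_
  rw [add_comm 2 k, show k + 2 - 1 = k + 1 by omega]
  push_cast
  ring_nf

theorem differentiable_quasiPartialQuotient (α c : ℝ) (g : ℂ → ℂ) (m : ℕ) :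
    Differentiable ℂ (quasiPartialQuotient α c g m) := by
  unfold quasiPartialQuotient
  fun_prop

theorem quasiPartialQuotient_apply_zero (α c : ℝ) (g : ℂ → ℂ) (m : ℕ) :
    quasiPartialQuotient α c g m 0 = 1 := by
  simp [quasiPartialQuotient_eq_sum_range]

theorem reducedSalagean_quasiPartialQuotient (α c : ℝ) {g : ℂ → ℂ} (hg : AnalyticAt ℂ g 0)
    (m : ℕ) : reducedSalagean α (quasiPartialQuotient α c g m) =
      quasiPartialQuotient α c (reducedSalagean α g) m := by
  ext z
  have hd : HasDerivAt (quasiPartialQuotient α c g m) (∑ k ∈ Finset.range (m - 1),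
      (((α + c) / (k + 1 + (α + c)) : ℝ) : ℂ) * powCoeff g (k + 2) *
        (((k + 1 : ℕ) : ℂ) * z ^ k)) z := by
    rw [funext (quasiPartialQuotient_eq_sum_range α c g m)]
    exact (HasDerivAt.fun_sum fun k _ => (hasDerivAt_pow (k + 1) z).const_mul _).const_add 1
  rw [reducedSalagean, hd.deriv, quasiPartialQuotient_eq_sum_range,
    quasiPartialQuotient_eq_sum_range, add_assoc, Finset.mul_sum, Finset.sum_div,
    ← Finset.sum_add_distrib]
  congr 1
  refine Finset.sum_congr rfl fun k _ => ?_
  rw [powCoeff_reducedSalagean α hg (k + 1)]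
  ring

theorem iterate_reducedSalagean_quasiPartialQuotient (α c : ℝ) {g : ℂ → ℂ}
    (hg : DifferentiableOn ℂ g (Metric.ball 0 1)) (m n : ℕ) :
    (reducedSalagean α)^[n] (quasiPartialQuotient α c g m) =
      quasiPartialQuotient α c ((reducedSalagean α)^[n] g) m := by
  induction n with
  | zero => rfl
  | succ n ih =>
    rw [Function.iterate_succ_apply', Function.iterate_succ_apply', ih]
    exact reducedSalagean_quasiPartialQuotient α c
      ((differentiableOn_iterate_reducedSalagean α hg n).analyticAt
        (Metric.ball_mem_nhds 0 one_pos)) m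

/-- The quasi-partial sums inherit a half plane from `h`: this joins the lower bound for the cosine
sums to the positivity of `Re (h - β)`. -/
theorem re_quasiPartialQuotient_gt {α c β : ℝ} (hc0 : 0 < α + c) (hcA : α + c ≤ gasperConstant)
    (hβ1 : β < 1) {h : ℂ → ℂ} (hh : DifferentiableOn ℂ h (Metric.ball 0 1)) (h0 : h 0 = 1)
    (hre : ∀ z : ℂ, ‖z‖ < 1 → β ≤ (h z).re) (m : ℕ) {z : ℂ} (hz : ‖z‖ < 1) :
    1 - 2 * (1 - β) * (α + c) / (α + c + 1) < (quasiPartialQuotient α c h m z).re := by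
  obtain ⟨γ, hγ⟩ : ∃ γ, γ = α + c := ⟨_, rfl⟩
  obtain ⟨r, hzr, hr1⟩ := exists_between hz
  have hr0 : 0 < r := (norm_nonneg z).trans_lt hzr
  have hρ : ‖z‖ / r < 1 := (div_lt_one hr0).mpr hzr
  rw [← hγ] at hc0 hcA ⊢
  have key := neg_two_mul_le_re_sum_powCoeff (p := fun z => h z - β) (hh.sub_const _)
    (fun z hz => by simpa using hre z hz) (fun k => γ / (k + 1 + γ)) (m - 1) (z := z) (r := r)
    (M := γ * (‖z‖ / r / (1 + γ))) hr0 hr1 (fun w hw => by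
      have := mul_le_mul_of_nonneg_left
        (re_sum_pow_div_ge (by linarith) hcA (m - 1) (w := w) (hw ▸ hρ.le)) hc0.le
      rw [hw, mul_neg, Finset.mul_sum] at this
      refine this.trans_eq (Finset.sum_congr rfl fun k _ => ?_)
      ring)
  have hcoeff : ∀ k : ℕ, powCoeff (fun z => h z - β) (k + 2) = powCoeff h (k + 2) := by
    intro k
    rw [powCoeff_succ, powCoeff_succ, iteratedDeriv_succ', iteratedDeriv_succ']
    simp only [deriv_sub_const_fun]
  simp only [hcoeff] at key
  rw [quasiPartialQuotient_eq_sum_range, Complex.add_re, Complex.one_re, ← hγ]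
  have h1 : ((fun z => h z - (β : ℂ)) 0).re = 1 - β := by simp [h0]
  rw [h1] at key
  have h2 : 2 * (γ * (‖z‖ / r / (1 + γ))) * (1 - β) < 2 * (1 - β) * γ / (γ + 1) := by
    have : 0 < 2 * (1 - β) * γ / (γ + 1) :=
      div_pos (mul_pos (by linarith) hc0) (by linarith)
    calc 2 * (γ * (‖z‖ / r / (1 + γ))) * (1 - β) = 2 * (1 - β) * γ / (γ + 1) * (‖z‖ / r) := by
          rw [add_comm 1 γ]; ring
      _ < _ := mul_lt_of_lt_one_right this hρ
  linarith

/-! ### Convergence to the Bernardi integral -/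

theorem ofReal_mul_cpow {s : ℝ} (hs : 0 < s) {z : ℂ} (hz : z ≠ 0) (w : ℂ) :
    ((s : ℂ) * z) ^ w = (s : ℂ) ^ w * z ^ w := by
  have hs' : (s : ℂ) ≠ 0 := by exact_mod_cast hs.ne'
  rw [Complex.cpow_def_of_ne_zero (mul_ne_zero hs' hz), Complex.cpow_def_of_ne_zero hs',
    Complex.cpow_def_of_ne_zero hz, Complex.log_ofReal_mul hs hz, Complex.ofReal_log hs.le,
    add_mul, Complex.exp_add]

theorem hasSum_powCoeff {g : ℂ → ℂ} (hg : DifferentiableOn ℂ g (Metric.ball 0 1)) {z : ℂ}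
    (hz : ‖z‖ < 1) : HasSum (fun k : ℕ => powCoeff g (k + 1) * z ^ k) (g z) := by
  convert! Complex.hasSum_taylorSeries_on_ball hg (mem_ball_zero_iff.mpr hz) using 2 with k
  rw [powCoeff_succ, sub_zero, smul_eq_mul, smul_eq_mul]
  ring

/-- Termwise integration of `s^(γ-1) g(s z)` over `0 ≤ s ≤ 1`. -/
theorem hasSum_integral_rpow_mul {g : ℂ → ℂ} (hg : DifferentiableOn ℂ g (Metric.ball 0 1))
    {γ : ℝ} (hγ : 0 < γ) {z : ℂ} (hz : ‖z‖ < 1) :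
    HasSum (fun k : ℕ => powCoeff g (k + 1) * z ^ k / ((k + γ : ℝ) : ℂ))
      (∫ s in (0 : ℝ)..1, ((s ^ (γ - 1) : ℝ) : ℂ) * g (s * z)) := by
  have hsum := (hasSum_powCoeff hg hz).summable.norm
  have hint : ∀ k : ℕ, ∫ s in (0 : ℝ)..1,
      ((s ^ (γ - 1 + k) : ℝ) : ℂ) * (powCoeff g (k + 1) * z ^ k) =
        powCoeff g (k + 1) * z ^ k / ((k + γ : ℝ) : ℂ) := by
    intro k
    have hk : (0 : ℝ) ≤ k := k.cast_nonneg
    rw [intervalIntegral.integral_mul_const, intervalIntegral.integral_ofReal,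
      integral_rpow (Or.inl (by linarith)), show γ - 1 + k + 1 = k + γ by ring,
      Real.one_rpow, Real.zero_rpow (by positivity)]
    push_cast
    ring
  simp only [← hint]
  refine intervalIntegral.hasSum_integral_of_dominated_convergence
    (fun k s => s ^ (γ - 1) * ‖powCoeff g (k + 1) * z ^ k‖) ?_ ?_ ?_ ?_ ?_
  · intro k
    refine AEMeasurable.aestronglyMeasurable ?_
    fun_prop
  · refine fun k => Eventually.of_forall fun s hs => ?_
    rw [Set.uIoc_of_le zero_le_one] at hs
    rw [norm_mul, Complex.norm_real, Real.norm_of_nonneg (by have := hs.1; positivity)]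
    refine mul_le_mul_of_nonneg_right
      (Real.rpow_le_rpow_of_exponent_ge hs.1 hs.2 ?_) (norm_nonneg _)
    linarith [(Nat.cast_nonneg k : (0 : ℝ) ≤ k)]
  · exact Eventually.of_forall fun s _ => hsum.mul_left _
  · simp only [tsum_mul_left]
    exact (intervalIntegral.intervalIntegrable_rpow' (by linarith)).mul_const _
  · refine Eventually.of_forall fun s hs => ?_
    rw [Set.uIoc_of_le zero_le_one] at hs
    have hsz : ‖(s : ℂ) * z‖ < 1 := by
      rw [norm_mul, Complex.norm_real, Real.norm_of_nonneg hs.1.le]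
      exact (mul_le_of_le_one_left (norm_nonneg z) hs.2).trans_lt hz
    convert! (hasSum_powCoeff hg hsz).mul_left ((s ^ (γ - 1) : ℝ) : ℂ) using 2 with k
    rw [Real.rpow_add hs.1, Real.rpow_natCast, mul_pow]
    push_cast
    ring

theorem bernardi_mulPow {α c : ℝ} (g : ℂ → ℂ) {z : ℂ} (hz0 : z ≠ 0) :
    bernardi α c (mulPow α g) z = z ^ (α : ℂ) * (((α + c : ℝ) : ℂ) *
      ∫ s in (0 : ℝ)..1, ((s ^ (α + c - 1) : ℝ) : ℂ) * g (s * z)) := by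
  have hzc : z ^ (c : ℂ) ≠ 0 := by simp [Complex.cpow_eq_zero_iff, hz0]
  have e : ∫ s in (0 : ℝ)..1, ((s * z) ^ ((c : ℂ) - 1) * mulPow α g (s * z)) * z =
      ∫ s in (0 : ℝ)..1, (z ^ (c : ℂ) * z ^ (α : ℂ)) *
        (((s ^ (α + c - 1) : ℝ) : ℂ) * g (s * z)) := by
    refine intervalIntegral.integral_congr_ae (Eventually.of_forall fun s hs => ?_)
    rw [Set.uIoc_of_le zero_le_one] at hs
    have hs0 : (s : ℂ) ≠ 0 := by exact_mod_cast hs.1.ne'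
    have h1 : ((s ^ (α + c - 1) : ℝ) : ℂ) = (s : ℂ) ^ ((c : ℂ) - 1) * (s : ℂ) ^ (α : ℂ) := by
      rw [Complex.ofReal_cpow hs.1.le, ← Complex.cpow_add _ _ hs0]
      push_cast
      ring_nf
    have h2 : z ^ ((c : ℂ) - 1) * z = z ^ (c : ℂ) := by
      rw [Complex.cpow_sub _ _ hz0, Complex.cpow_one, div_mul_cancel₀ _ hz0]
    rw [mulPow, ofReal_mul_cpow hs.1 hz0, ofReal_mul_cpow hs.1 hz0, h1, ← h2]
    ring
  have hcancel (x b a I : ℂ) (hb : b ≠ 0) : x / b * (b * a * I) = a * (x * I) := by field_simp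
  rw [bernardi, e, intervalIntegral.integral_const_mul]
  exact hcancel _ _ _ _ hzc

theorem tendsto_quasiPartialQuotient {α c : ℝ} (hc0 : 0 < α + c) {g : ℂ → ℂ}
    (hg : DifferentiableOn ℂ g (Metric.ball 0 1)) (hg0 : g 0 = 1) {z : ℂ} (hz : ‖z‖ < 1) :
    Tendsto (fun m => quasiPartialQuotient α c g m z) atTop
      (𝓝 (((α + c : ℝ) : ℂ) * ∫ s in (0 : ℝ)..1, ((s ^ (α + c - 1) : ℝ) : ℂ) * g (s * z))) := by
  refine (((hasSum_integral_rpow_mul hg hc0 hz).mul_left _).tendsto_sum_nat).congr' ?_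
  filter_upwards [eventually_ge_atTop 1] with m hm
  obtain ⟨m, rfl⟩ := Nat.exists_eq_add_of_le' hm
  have hc0' : ((α + c : ℝ) : ℂ) ≠ 0 := by exact_mod_cast hc0.ne'
  rw [quasiPartialQuotient_eq_sum_range, Finset.sum_range_succ', Nat.add_sub_cancel, add_comm]
  congr 1
  · rw [powCoeff_succ, iteratedDeriv_zero, hg0]
    simp only [Nat.factorial_zero, Nat.cast_one, div_one, pow_zero, mul_one, Nat.cast_zero,
      zero_add]
    exact mul_one_div_cancel hc0'
  · refine Finset.sum_congr rfl fun k _ => ?_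
    push_cast
    ring

/-! ### The quasi-partial sums as powers of functions of the class -/

/-- Along a ray, `s^α (Re q(s z) - δ)` vanishes at `s = 0` and has positive derivative when
`Re (q + z q'/α) > δ`, so that `Re q > δ` as well. -/
theorem re_gt_of_re_reducedSalagean_gt {α δ : ℝ} (hα : 0 < α) {q : ℂ → ℂ}
    (hq : DifferentiableOn ℂ q (Metric.ball 0 1))
    (h : ∀ z : ℂ, ‖z‖ < 1 → δ < (reducedSalagean α q z).re) {z : ℂ} (hz : ‖z‖ < 1) :
    δ < (q z).re := by
  have hmem : ∀ s ∈ Set.Icc (0 : ℝ) 1, ‖(s : ℂ) * z‖ < 1 := fun s hs => by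
    rw [norm_mul, Complex.norm_real, Real.norm_of_nonneg hs.1]
    exact (mul_le_of_le_one_left (norm_nonneg z) hs.2).trans_lt hz
  set φ : ℝ → ℝ := fun s => s ^ α * ((q (s * z)).re - δ)
  have hmul : ContinuousOn (fun s : ℝ => q ((s : ℂ) * z)) (Set.Icc 0 1) :=
    hq.continuousOn.comp (by fun_prop) fun s hs => mem_ball_zero_iff.mpr (hmem s hs)
  have hcont : ContinuousOn φ (Set.Icc 0 1) :=
    (Real.continuous_rpow_const hα.le).continuousOn.mul
      ((Complex.continuous_re.comp_continuousOn hmul).sub continuousOn_const)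
  have hmono : StrictMonoOn φ (Set.Icc 0 1) := by
    refine strictMonoOn_of_deriv_pos (convex_Icc 0 1) hcont fun s hs => ?_
    rw [interior_Icc] at hs
    have hs1 := hmem s ⟨hs.1.le, hs.2.le⟩
    have hqd : HasDerivAt q (deriv q (s * z)) (s * z) :=
      (hq.differentiableAt (Metric.isOpen_ball.mem_nhds (mem_ball_zero_iff.mpr hs1))).hasDerivAt
    have h1 : HasDerivAt (fun s : ℝ => (q ((s : ℂ) * z)).re) (deriv q (s * z) * z).re s := by
      have h2 : HasDerivAt (fun w : ℂ => q (w * z)) (deriv q (s * z) * (1 * z)) (s : ℂ) :=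
        HasDerivAt.comp (s : ℂ) (h₂ := q) (h := fun w : ℂ => w * z) hqd
          ((hasDerivAt_id' (s : ℂ)).mul_const z)
      rw [one_mul] at h2
      exact h2.real_of_complex
    have h3 : HasDerivAt φ (α * s ^ (α - 1) * ((q (s * z)).re - δ) +
        s ^ α * (deriv q (s * z) * z).re) s :=
      (Real.hasDerivAt_rpow_const (Or.inl hs.1.ne')).mul (h1.sub_const δ)
    rw [h3.deriv]
    have h4 := h (s * z) hs1
    have h5 : (reducedSalagean α q (s * z)).re =
        (q (s * z)).re + s * (deriv q (s * z) * z).re / α := by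
      rw [reducedSalagean, Complex.add_re, Complex.div_ofReal_re, mul_assoc,
        Complex.re_ofReal_mul, mul_comm z]
    have h6 : s ^ α = s ^ (α - 1) * s := by
      rw [Real.rpow_sub_one hs.1.ne', div_mul_cancel₀ _ hs.1.ne']
    have h7 : α * s ^ (α - 1) * ((q (s * z)).re - δ) + s ^ α * (deriv q (s * z) * z).re =
        α * s ^ (α - 1) * ((reducedSalagean α q (s * z)).re - δ) := by
      rw [h5, h6]
      field_simp
      ring
    rw [h7]
    exact mul_pos (mul_pos hα (Real.rpow_pos_of_pos hs.1 _)) (by linarith)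
  have := hmono (Set.left_mem_Icc.mpr zero_le_one) (Set.right_mem_Icc.mpr zero_le_one) one_pos
  simp only [φ, Real.zero_rpow hα.ne', zero_mul, Real.one_rpow, one_mul, Complex.ofReal_one] at this
  linarith

theorem re_gt_of_re_iterate_reducedSalagean_gt {α δ : ℝ} (hα : 0 < α) (n : ℕ) {q : ℂ → ℂ}
    (hq : DifferentiableOn ℂ q (Metric.ball 0 1))
    (h : ∀ z : ℂ, ‖z‖ < 1 → δ < ((reducedSalagean α)^[n] q z).re) {z : ℂ} (hz : ‖z‖ < 1) :
    δ < (q z).re := by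
  induction n generalizing z with
  | zero => exact h z hz
  | succ n ih =>
    refine ih (fun z hz => ?_) hz
    simp only [Function.iterate_succ_apply'] at h
    exact re_gt_of_re_reducedSalagean_gt hα (differentiableOn_iterate_reducedSalagean α hq n) h hz

/-- A function `q` with positive real part and `q 0 = 1` is the quotient `F(z)^α / z^α` of
`F(z) = z q(z)^(1/α)`. -/
theorem exists_isPowerQuotient {α : ℝ} (hα : 0 < α) {q : ℂ → ℂ}
    (hq : DifferentiableOn ℂ q (Metric.ball 0 1)) (hq0 : q 0 = 1)
    (hre : ∀ z : ℂ, ‖z‖ < 1 → 0 < (q z).re) : ∃ F, ClassA F ∧ IsPowerQuotient α F q := by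
  have hα' : (α : ℂ) ≠ 0 := by exact_mod_cast hα.ne'
  have hslit : ∀ z ∈ Metric.ball (0 : ℂ) 1, q z ∈ Complex.slitPlane := fun z hz =>
    Or.inl (hre z (mem_ball_zero_iff.mp hz))
  set G : ℂ → ℂ := fun z => Complex.exp (Complex.log (q z) / α)
  have hlog : DifferentiableOn ℂ (fun z => Complex.log (q z)) (Metric.ball 0 1) := hq.clog hslit
  have hG : DifferentiableOn ℂ G (Metric.ball 0 1) := (hlog.div_const _).cexp
  have h0 : (0 : ℂ) ∈ Metric.ball (0 : ℂ) 1 := Metric.mem_ball_self one_pos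
  have hball := Metric.isOpen_ball.mem_nhds h0
  have hG0 : G 0 = 1 := by simp [G, hq0]
  refine ⟨fun z => z * G z, ⟨differentiableOn_id.mul hG, zero_mul _, ?_⟩, hq, ?_⟩
  · have := (hasDerivAt_id' (0 : ℂ)).fun_mul (hG.differentiableAt hball).hasDerivAt
    rw [this.deriv, hG0]
    simp
  -- near the origin `log q / α` is small, so the principal logarithm undoes the exponential
  have him : ∀ᶠ z in 𝓝 (0 : ℂ), (Complex.log (q z) / α).im ∈ Set.Ioo (-Real.pi) Real.pi := by
    have hc : ContinuousAt (fun z => (Complex.log (q z) / α).im) 0 :=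
      Complex.continuous_im.continuousAt.comp
        ((hlog.differentiableAt hball).continuousAt.div_const _)
    refine hc.eventually_mem (isOpen_Ioo.mem_nhds ?_)
    simp [hq0, Real.pi_pos]
  filter_upwards [him.filter_mono nhdsWithin_le_nhds, nhdsWithin_le_nhds hball,
    self_mem_nhdsWithin] with z hz hzb hz0
  rw [mul_div_cancel_left₀ _ hz0, Complex.cpow_def_of_ne_zero (Complex.exp_ne_zero _),
    Complex.log_exp hz.1 hz.2.le, div_mul_cancel₀ _ hα',
    Complex.exp_log (Complex.slitPlane_ne_zero (hslit z hzb))]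

theorem IsPowerQuotient.apply_zero {α : ℝ} {f g : ℂ → ℂ} (hf : ClassA f)
    (hg : IsPowerQuotient α f g) : g 0 = 1 := by
  have hball : Metric.ball (0 : ℂ) 1 ∈ 𝓝 0 := Metric.ball_mem_nhds 0 one_pos
  have h1 : Tendsto g (𝓝[≠] 0) (𝓝 (g 0)) :=
    (hg.1.differentiableAt hball).continuousAt.tendsto.mono_left nhdsWithin_le_nhds
  have h2 : Tendsto (fun z => f z / z) (𝓝[≠] 0) (𝓝 1) := by
    have := hasDerivAt_iff_tendsto_slope.mp (hf.1.differentiableAt hball).hasDerivAt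
    rw [hf.2.2] at this
    refine this.congr fun z => ?_
    rw [slope_def_field, hf.2.1, sub_zero, sub_zero]
  have h3 : Tendsto (fun z => (f z / z) ^ (α : ℂ)) (𝓝[≠] 0) (𝓝 1) := by
    have := (continuousAt_cpow_const (b := (α : ℂ)) Complex.one_mem_slitPlane).tendsto.comp h2
    rwa [Complex.one_cpow] at this
  exact tendsto_nhds_unique h1 (h3.congr' (hg.2.mono fun z hz => hz.symm))

theorem IsPowerQuotient.eqOn {α : ℝ} {f g g' : ℂ → ℂ} (hg : IsPowerQuotient α f g)
    (hg' : IsPowerQuotient α f g') : Set.EqOn g g' (Metric.ball 0 1) := by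
  refine (hg.1.analyticOnNhd Metric.isOpen_ball).eqOn_of_preconnected_of_frequently_eq
    (hg'.1.analyticOnNhd Metric.isOpen_ball) (convex_ball 0 1).isPreconnected
    (Metric.mem_ball_self one_pos) (Eventually.frequently ?_)
  filter_upwards [hg.2, hg'.2] with z h1 h2
  rw [h1, h2]

theorem eqOn_iterate_reducedSalagean {g g' : ℂ → ℂ} (α : ℝ)
    (h : Set.EqOn g g' (Metric.ball 0 1)) (n : ℕ) :
    Set.EqOn ((reducedSalagean α)^[n] g) ((reducedSalagean α)^[n] g') (Metric.ball 0 1) := by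
  induction n with
  | zero => exact h
  | succ n ih =>
    intro z hz
    rw [Function.iterate_succ_apply', Function.iterate_succ_apply', reducedSalagean,
      reducedSalagean, ih hz,
      (ih.eventuallyEq_of_mem (Metric.isOpen_ball.mem_nhds hz)).deriv_eq]

theorem one_sub_two_mul_div_nonneg_iff {γ β : ℝ} (hγ : 0 < γ) :
    0 ≤ 1 - 2 * (1 - β) * γ / (γ + 1) ↔ (γ - 1) / (2 * γ) ≤ β := by
  rw [sub_nonneg, div_le_one (by linarith), div_le_iff₀ (by linarith)]
  constructor <;> intro h <;> linarith

end QuasiPartial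

open QuasiPartial in
theorem theorem3p1 (n : ℕ) (α β c : ℝ) (hα : 0 < α) (hβ0 : 0 ≤ β) (hβ1 : β < 1)
    (hc0 : 0 < α + c) (hcA : α + c ≤ gasperConstant)
    (f : ℂ → ℂ) (hf : f ∈ opoolaClass n α β)
    (g : ℂ → ℂ) (hg : IsPowerQuotient α f g) :
    (∀ z : ℂ, ‖z‖ < 1 → z ≠ 0 →
      Tendsto (fun m => mulPow α (quasiPartialQuotient α c g m) z) atTop
        (𝓝 (bernardi α c (mulPow α g) z))) ∧
    (∀ m : ℕ, 1 ≤ m → ∀ z : ℂ, ‖z‖ < 1 → z ≠ 0 →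
      1 - 2 * (1 - β) * (α + c) / (α + c + 1) <
        (salageanQuotient n α (quasiPartialQuotient α c g m) z).re) ∧
    (0 ≤ 1 - 2 * (1 - β) * (α + c) / (α + c + 1) ↔ (α + c - 1) / (2 * (α + c)) ≤ β) ∧
    ((α + c - 1) / (2 * (α + c)) ≤ β → ∀ m : ℕ, 1 ≤ m →
      ∃ F : ℂ → ℂ, F ∈ opoolaClass n α (1 - 2 * (1 - β) * (α + c) / (α + c + 1)) ∧
        IsPowerQuotient α F (quasiPartialQuotient α c g m)) := by
  obtain ⟨hfA, g', hg', hre⟩ := hf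
  have hg0 : g 0 = 1 := hg.apply_zero hfA
  have hh := differentiableOn_iterate_reducedSalagean α hg.1 n
  have hh0 : (reducedSalagean α)^[n] g 0 = 1 := by rw [iterate_reducedSalagean_apply_zero, hg0]
  have hhre : ∀ z : ℂ, ‖z‖ < 1 → β ≤ ((reducedSalagean α)^[n] g z).re := by
    intro z hz
    rcases eq_or_ne z 0 with rfl | hz0
    · rw [hh0, Complex.one_re]
      exact hβ1.le
    · have := hre z hz hz0
      rw [salageanQuotient_eq hα hg'.1 n hz hz0,
        ← eqOn_iterate_reducedSalagean α (hg.eqOn hg') n (mem_ball_zero_iff.mpr hz)] at this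
      exact this.le
  have hQ : ∀ m : ℕ, DifferentiableOn ℂ (quasiPartialQuotient α c g m) (Metric.ball 0 1) :=
    fun m => (differentiable_quasiPartialQuotient α c g m).differentiableOn
  have hQre : ∀ (m : ℕ) (z : ℂ), ‖z‖ < 1 → 1 - 2 * (1 - β) * (α + c) / (α + c + 1) <
      ((reducedSalagean α)^[n] (quasiPartialQuotient α c g m) z).re := by
    intro m z hz
    rw [iterate_reducedSalagean_quasiPartialQuotient α c hg.1]
    exact re_quasiPartialQuotient_gt hc0 hcA hβ1 hh hh0 hhre m hz
  have hbound : ∀ (m : ℕ) (z : ℂ), ‖z‖ < 1 → z ≠ 0 →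
      1 - 2 * (1 - β) * (α + c) / (α + c + 1) <
        (salageanQuotient n α (quasiPartialQuotient α c g m) z).re := by
    intro m z hz hz0
    rw [salageanQuotient_eq hα (hQ m) n hz hz0]
    exact hQre m z hz
  refine ⟨fun z hz hz0 => ?_, fun m _ => hbound m, one_sub_two_mul_div_nonneg_iff hc0, fun hβ m _ => ?_⟩
  · rw [bernardi_mulPow g hz0]
    exact (tendsto_quasiPartialQuotient hc0 hg.1 hg0 hz).const_mul _
  · have hδ := (one_sub_two_mul_div_nonneg_iff hc0).mpr hβ
    obtain ⟨F, hF, hFq⟩ := exists_isPowerQuotient hα (hQ m)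
      (quasiPartialQuotient_apply_zero α c g m) fun z hz =>
        hδ.trans_lt (re_gt_of_re_iterate_reducedSalagean_gt hα n (hQ m) (hQre m) hz)
    exact ⟨F, ⟨hF, _, hFq, hbound m⟩, hFq⟩
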